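/- Let $N\ge 1$ and $\alpha\in[0,1]$. For $\mathbf x=(x,y)\in\mathbb R^2\setminus\{0\}$ put $\mathbf x^{-\perp}=(-y,x)/(x^2+y^2)$, and on $\mathbb R^{2N}=(\mathbb R^2)^N$ let $$D_j=-i\nabla_{\mathbf x_j}+\alpha\sum_{k\ne j}(\mathbf x_j-\mathbf x_k)^{-\perp},\qquad j=1,\dots,N .$$ Let $\mathscr D^N_\alpha$ be the set of all permutation-symmetric $\Psi\in L^2(\mathbb R^{2N};\mathbb C)$ such that, for every $j$, $D_j\Psi$, taken in the sense of distributions on $\{(\mathbf x_1,\dots,\mathbf x_N):\mathbf x_k\neq\mathbf x_l \text{ for } k\neq l\}$, belongs to $L^2$. Let $Q_0=[0,1]^2$, and define the Dirichlet ground-state energy of $N$ ideal anyons with statistics parameter $\alpha$ on the unit square by $$E^D_N(\alpha)=\inf\Big\{\sum_{j=1}^N\int_{Q_0^N}|D_j\Psi|^2\ :\ \Psi\in\mathscr D^N_\alpha,\ \Psi \text{ has compact support in } \big((0,1)^2\big)^N,\ \int_{Q_0^N}|\Psi|^2=1\Big\}.$$ **Proposition (Global upper bound).** There exists a constant $C>0$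 such that for all $0\le\alpha\le1$ and all integers $N\ge1$, $$E^D_N(\alpha)\le C\,(N+\alpha N^2).$$ -/

import Mathlib

open MeasureTheory
open scoped ENNReal ContDiff

namespace Anyon

/-- The one-particle configuration space `ℝ²`. -/
abbrev Plane : Type := EuclideanSpace ℝ (Fin 2)

/-- The `N`-particle configuration space `(ℝ²)^N = ℝ^{2N}`, with Lebesgue measure. -/
abbrev Config (N : ℕ) : Type := Fin N → Plane

/-- `x^{-⊥} = (-y, x) / (x² + y²)`, the potential of an Aharonov-Bohm flux at the origin. -/
noncomputable def invPerp (x : Plane) : Plane :=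
  (‖x‖ ^ 2)⁻¹ • !₂[-(x 1), x 0]

/-- The vector potential `A_j(x) = ∑_{k ≠ j} (x_j - x_k)^{-⊥}` felt by particle `j`. -/
noncomputable def vecPot {N : ℕ} (j : Fin N) (x : Config N) : Plane :=
  ∑ k ∈ Finset.univ.erase j, invPerp (x j - x k)

/-- The set of configurations of pairwise distinct points, i.e. `ℝ^{2N}` without the diagonals. -/
def offDiagonal (N : ℕ) : Set (Config N) :=
  {x | Function.Injective x}

/-- The coordinate direction in `ℝ^{2N}` along the `i`-th coordinate of particle `j`. -/
noncomputable def direction {N : ℕ} (j : Fin N) (i : Fin 2) : Config N :=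
  Pi.single j (EuclideanSpace.single i 1)

/-- Test functions: smooth, with compact support away from the diagonals. -/
structure IsTestFunction {N : ℕ} (φ : Config N → ℂ) : Prop where
  smooth : ContDiff ℝ ∞ φ
  compact_support : HasCompactSupport φ
  support_subset : tsupport φ ⊆ offDiagonal N

/-- `G j i` is the `i`-th component of `D_j Ψ = (-i ∇_j + α A_j) Ψ` in the sense of distributions
on `ℝ^{2N}` without the diagonals (where `A_j` is smooth). -/
def IsMagneticGradient {N : ℕ} (α : ℝ) (Ψ : Config N → ℂ)
    (G : Fin N → Fin 2 → Config N → ℂ) : Prop :=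
  ∀ (j : Fin N) (i : Fin 2) (φ : Config N → ℂ), IsTestFunction φ →
    ∫ x, G j i x * φ x =
      ∫ x, Ψ x * (Complex.I * fderiv ℝ φ x (direction j i)
        + (α : ℂ) * ((vecPot j x i : ℝ) : ℂ) * φ x)

/-- Permutation symmetry (up to null sets) of an `N`-particle wave function. -/
def IsBosonic {N : ℕ} (Ψ : Config N → ℂ) : Prop :=
  ∀ σ : Equiv.Perm (Fin N), (fun x : Config N => Ψ (x ∘ σ)) =ᵐ[volume] Ψ

/-- `Ψ` belongs to the (maximal) domain of `D_α = (D_j)_j` in `L²_sym(ℝ^{2N})`, with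
`D_α Ψ = G`. The family `G` is determined by `Ψ` up to null sets. -/
structure HasMagneticGradient {N : ℕ} (α : ℝ) (Ψ : Config N → ℂ)
    (G : Fin N → Fin 2 → Config N → ℂ) : Prop where
  memLp : MemLp Ψ 2 volume
  bosonic : IsBosonic Ψ
  memLp_gradient : ∀ j i, MemLp (G j i) 2 volume
  isMagneticGradient : IsMagneticGradient α Ψ G

/-- `Ω^N ⊆ ℝ^{2N}`. -/
def power (N : ℕ) (Ω : Set Plane) : Set (Config N) :=
  Set.univ.pi fun _ => Ω

/-- `Ψ` has compact (essential) support inside the `N`-fold product of the interior of `Ω`. -/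
def HasCompactSupportIn {N : ℕ} (Ω : Set Plane) (Ψ : Config N → ℂ) : Prop :=
  ∃ K : Set Plane, IsCompact K ∧ K ⊆ interior Ω ∧ ∀ᵐ x : Config N, x ∉ power N K → Ψ x = 0

/-- The kinetic energy `∑_j ∫_{Ω^N} |D_j Ψ|²`, where `G = D_α Ψ`. -/
noncomputable def kineticEnergy {N : ℕ} (Ω : Set Plane)
    (G : Fin N → Fin 2 → Config N → ℂ) : ℝ≥0∞ :=
  ∑ j, ∫⁻ x in power N Ω, ∑ i, ‖G j i x‖ₑ ^ 2

/-- The Dirichlet ground-state energy `E_N^D(α; Ω)`: the infimum of the kinetic energy over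
normalized `Ψ` in the domain of `D_α` that have compact support in `Ω`. It is `∞` if there is no
such `Ψ`. -/
noncomputable def dirichletEnergy (N : ℕ) (α : ℝ) (Ω : Set Plane) : ℝ≥0∞ :=
  sInf {e | ∃ (Ψ : Config N → ℂ) (G : Fin N → Fin 2 → Config N → ℂ),
    HasMagneticGradient α Ψ G ∧ HasCompactSupportIn Ω Ψ ∧
    ∫⁻ x in power N Ω, ‖Ψ x‖ₑ ^ 2 = 1 ∧ e = kineticEnergy Ω G}

/-- The unit square `Q₀ = [0,1]²`. -/
def unitSquare : Set Plane :=
  {x | ∀ i, x i ∈ Set.Icc (0 : ℝ) 1}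

end Anyon

/-!
The trial state has one smooth bump in each cell of a grid of mesh `1 / m`, where `m ^ 2` is of
order `1 + α * N`. Since different cells are separated by a line, the mutual vector potential of two
particles in different cells is a gradient, and a phase built from a branch of the arctangent
removes it. For two particles in the same cell the Jastrow factor `‖x - y‖ ^ α` leaves an
interaction of size `α / ‖x - y‖`, which is square integrable against the weight
`‖x - y‖ ^ (2 * α)` with an integral of order `α`.

Integrating out one particle at a time, the Jastrow factors remove a mass of order
`α * N / m ^ 2` from each bump, that is, at most half of it once `m ^ 2` is a large multiple of
`α * N`. The bumps then cost an energy of order `m ^ 2` per particle, and the remaining interaction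
costs `α * N + (α * N / m) ^ 2`, which is of order `α * N`.
-/

namespace Anyon

open Filter Topology

section Bump

/-- A smooth wave of period `1` that vanishes near the integers. -/
noncomputable def bumpWave (t : ℝ) : ℝ :=
  Real.smoothTransition (-Real.cos (2 * Real.pi * t))

lemma contDiff_bumpWave : ContDiff ℝ 1 bumpWave :=
  (Real.smoothTransition.contDiff (n := 1)).comp (by fun_prop)

lemma bumpWave_periodic : Function.Periodic bumpWave 1 := fun t => by
  rw [bumpWave, bumpWave, mul_add, mul_one, Real.cos_add_two_pi]

lemma bumpWave_eventuallyEq_zero (n : ℤ) : bumpWave =ᶠ[𝓝 (n : ℝ)] 0 := by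
  have hcont : Continuous fun t : ℝ => Real.cos (2 * Real.pi * t) := by fun_prop
  have hpos : 0 < Real.cos (2 * Real.pi * n) := by
    rw [mul_comm, Real.cos_int_mul_two_pi]
    exact one_pos
  filter_upwards [hcont.continuousAt.eventually (lt_mem_nhds hpos)] with t ht
  exact Real.smoothTransition.zero_of_nonpos (neg_nonpos.mpr ht.le)

lemma exists_abs_deriv_bumpWave_le : ∃ K : ℝ, 0 < K ∧ ∀ t, |deriv bumpWave t| ≤ K := by
  have hperiodic : Function.Periodic (deriv bumpWave) 1 := fun t => by
    rw [← deriv_comp_add_const, bumpWave_periodic.funext]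
  obtain ⟨K, hK, hbound⟩ := (hperiodic.isBounded_of_continuous one_ne_zero
    (contDiff_bumpWave.continuous_deriv le_rfl)).exists_pos_norm_le
  exact ⟨K, hK, fun t => hbound _ (Set.mem_range_self t)⟩

lemma integral_bumpWave_sq_pos : 0 < ∫ t in (0 : ℝ)..1, bumpWave t ^ 2 := by
  have hhalf : bumpWave (1 / 2) = 1 := by
    rw [bumpWave, show 2 * Real.pi * (1 / 2) = Real.pi by ring, Real.cos_pi, neg_neg,
      Real.smoothTransition.one]
  refine intervalIntegral.integral_pos one_pos
    (contDiff_bumpWave.continuous.pow 2).continuousOn (fun _ _ => sq_nonneg _)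
    ⟨1 / 2, by norm_num, ?_⟩
  rw [hhalf]
  norm_num

/-- The wave `bumpWave`, compressed to period `1/m` and cut off outside the unit interval. -/
noncomputable def bumpLine (m : ℕ) : ℝ → ℝ :=
  (Set.Icc (0 : ℝ) 1).indicator fun t => bumpWave (m * t)

/-- The unit interval without the points of the grid `m⁻¹ℤ`. -/
def openCells (m : ℕ) : Set ℝ :=
  {t | t ∈ Set.Ioo (0 : ℝ) 1 ∧ ∀ n : ℤ, m * t ≠ n}

lemma bumpLine_nonneg (m : ℕ) (t : ℝ) : 0 ≤ bumpLine m t :=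
  Set.indicator_nonneg (fun _ _ => Real.smoothTransition.nonneg _) t

lemma bumpLine_le_one (m : ℕ) (t : ℝ) : bumpLine m t ≤ 1 :=
  Set.indicator_le' (fun _ _ => Real.smoothTransition.le_one _) (fun _ _ => zero_le_one) t

lemma bumpLine_eventuallyEq_bumpWave (m : ℕ) {t : ℝ} (ht : t ∈ Set.Ioo (0 : ℝ) 1) :
    bumpLine m =ᶠ[𝓝 t] fun s => bumpWave (m * s) := by
  filter_upwards [Ioo_mem_nhds ht.1 ht.2] with s hs
  exact Set.indicator_of_mem (Set.Ioo_subset_Icc_self hs) _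

lemma bumpLine_eventuallyEq_zero {m : ℕ} {t : ℝ} (ht : t ∉ openCells m) :
    bumpLine m =ᶠ[𝓝 t] 0 := by
  by_cases hgrid : ∃ n : ℤ, m * t = n
  · obtain ⟨n, hn⟩ := hgrid
    have hcont : Tendsto (fun s : ℝ => m * s) (𝓝 t) (𝓝 (n : ℝ)) :=
      hn ▸ (continuous_const_mul (m : ℝ)).tendsto t
    filter_upwards [hcont.eventually (bumpWave_eventuallyEq_zero n)] with s hs
    exact Set.indicator_apply_eq_zero.mpr fun _ => hs
  · push Not at hgrid
    have hout : t ∉ Set.Icc (0 : ℝ) 1 := fun h => ht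
      ⟨⟨h.1.lt_of_ne fun h0 => hgrid 0 (by simp [← h0]),
        h.2.lt_of_ne fun h1 => hgrid m (by simp [h1])⟩, hgrid⟩
    filter_upwards [isClosed_Icc.isOpen_compl.mem_nhds hout] with s hs
    exact Set.indicator_of_notMem hs _

lemma contDiff_bumpLine (m : ℕ) : ContDiff ℝ 1 (bumpLine m) := by
  refine contDiff_iff_contDiffAt.mpr fun t => ?_
  by_cases ht : t ∈ openCells m
  · exact (contDiff_bumpWave.comp (contDiff_const.mul contDiff_id)).contDiffAt.congr_of_eventuallyEq
      (bumpLine_eventuallyEq_bumpWave m ht.1)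
  · exact contDiffAt_const.congr_of_eventuallyEq (bumpLine_eventuallyEq_zero ht)

lemma abs_deriv_bumpLine_le {K : ℝ} (hK : ∀ t, |deriv bumpWave t| ≤ K) (m : ℕ) (t : ℝ) :
    |deriv (bumpLine m) t| ≤ K * m := by
  by_cases ht : t ∈ openCells m
  · rw [(bumpLine_eventuallyEq_bumpWave m ht.1).deriv_eq, deriv_comp_mul_left, smul_eq_mul,
      abs_mul, Nat.abs_cast, mul_comm]
    gcongr
    exact hK _
  · rw [(bumpLine_eventuallyEq_zero ht).deriv_eq]
    simpa using mul_nonneg ((abs_nonneg _).trans (hK 0)) m.cast_nonneg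

lemma integral_bumpLine_sq {m : ℕ} (hm : 0 < m) :
    ∫ t, bumpLine m t ^ 2 = ∫ t in (0 : ℝ)..1, bumpWave t ^ 2 := by
  have hm' : (m : ℝ) ≠ 0 := by positivity
  have hsq (t : ℝ) : bumpLine m t ^ 2 =
      (Set.Icc (0 : ℝ) 1).indicator (fun t => bumpWave (m * t) ^ 2) t := by
    by_cases h : t ∈ Set.Icc (0 : ℝ) 1 <;> simp [bumpLine, h]
  have hperiodic : Function.Periodic (fun t => bumpWave t ^ 2) 1 :=
    bumpWave_periodic.comp (· ^ 2)
  have hmul := hperiodic.intervalIntegral_add_zsmul_eq m 0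
    (fun _ _ => (contDiff_bumpWave.continuous.pow 2).intervalIntegrable _ _)
  simp only [zero_add, natCast_zsmul, nsmul_eq_mul, mul_one] at hmul
  simp_rw [hsq]
  rw [integral_indicator measurableSet_Icc, integral_Icc_eq_integral_Ioc,
    ← intervalIntegral.integral_of_le zero_le_one,
    intervalIntegral.integral_comp_mul_left (fun t => bumpWave t ^ 2) hm',
    mul_zero, mul_one, hmul, smul_eq_mul, inv_mul_cancel_left₀ hm']

/-- The one-particle amplitude of the trial state: one bump in each cell of the grid of mesh `1/m`
in the unit square. -/
noncomputable def bump (m : ℕ) (x : Plane) : ℝ :=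
  bumpLine m (x 0) * bumpLine m (x 1)

/-- The unit square without the lines of the grid of mesh `1/m`. -/
def gridInterior (m : ℕ) : Set Plane :=
  {x | ∀ i, x i ∈ openCells m}

/-- The mass of `bump m` squared, which does not depend on `m`. -/
noncomputable def bumpMass : ℝ :=
  (∫ t in (0 : ℝ)..1, bumpWave t ^ 2) ^ 2

lemma bumpMass_pos : 0 < bumpMass :=
  pow_pos integral_bumpWave_sq_pos 2

lemma bump_nonneg (m : ℕ) (x : Plane) : 0 ≤ bump m x :=
  mul_nonneg (bumpLine_nonneg _ _) (bumpLine_nonneg _ _)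

lemma bump_le_one (m : ℕ) (x : Plane) : bump m x ≤ 1 :=
  mul_le_one₀ (bumpLine_le_one _ _) (bumpLine_nonneg _ _) (bumpLine_le_one _ _)

lemma contDiff_bump (m : ℕ) : ContDiff ℝ 1 (bump m) := by
  have hcomp (i : Fin 2) : ContDiff ℝ 1 fun x : Plane => bumpLine m (x i) :=
    (contDiff_bumpLine m).comp (by fun_prop)
  exact (hcomp 0).mul (hcomp 1)

lemma bump_eventuallyEq_zero {m : ℕ} {x : Plane} (hx : x ∉ gridInterior m) :
    bump m =ᶠ[𝓝 x] 0 := by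
  obtain ⟨i, hi⟩ : ∃ i, x i ∉ openCells m := not_forall.mp hx
  have hcont : Continuous fun y : Plane => y i := by fun_prop
  filter_upwards [hcont.continuousAt.eventually (bumpLine_eventuallyEq_zero hi)] with y hy
  fin_cases i
  · exact mul_eq_zero_of_left hy _
  · exact mul_eq_zero_of_right _ hy

lemma tsupport_bump_subset (m : ℕ) : tsupport (bump m) ⊆ gridInterior m := fun _ hx =>
  by_contra fun h => notMem_tsupport_iff_eventuallyEq.mpr (bump_eventuallyEq_zero h) hx

lemma gridInterior_subset_interior (m : ℕ) : gridInterior m ⊆ interior unitSquare := by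
  have hopen : IsOpen {x : Plane | ∀ i, x i ∈ Set.Ioo (0 : ℝ) 1} := by
    rw [Set.ofPred_forall]
    exact isOpen_iInter_of_finite fun i => isOpen_Ioo.preimage (by fun_prop)
  have hsubset : {x : Plane | ∀ i, x i ∈ Set.Ioo (0 : ℝ) 1} ⊆ unitSquare :=
    fun _ hx i => Set.Ioo_subset_Icc_self (hx i)
  exact fun x hx => interior_maximal hsubset hopen fun i => (hx i).1

lemma isCompact_unitSquare : IsCompact unitSquare := by
  have hpreimage : unitSquare = (EuclideanSpace.equiv (Fin 2) ℝ).toHomeomorph ⁻¹'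
      (Set.univ.pi fun _ => Set.Icc (0 : ℝ) 1) := by
    ext x
    exact ⟨fun h i _ => h i, fun h i => h i trivial⟩
  rw [hpreimage, Homeomorph.isCompact_preimage]
  exact isCompact_univ_pi fun _ => isCompact_Icc

lemma hasCompactSupport_bump (m : ℕ) : HasCompactSupport (bump m) :=
  isCompact_unitSquare.of_isClosed_subset (isClosed_tsupport _)
    ((tsupport_bump_subset m).trans ((gridInterior_subset_interior m).trans interior_subset))

lemma abs_fderiv_bump_le {m : ℕ} {K : ℝ} (hK : ∀ t, |deriv (bumpLine m) t| ≤ K)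
    (x : Plane) (i : Fin 2) :
    |fderiv ℝ (bump m) x (EuclideanSpace.single i 1)| ≤ K := by
  have hcomp (k : Fin 2) : HasFDerivAt (fun y : Plane => bumpLine m (y k))
      (deriv (bumpLine m) (x k) • (EuclideanSpace.proj k : Plane →L[ℝ] ℝ)) x :=
    ((contDiff_bumpLine m).differentiable one_ne_zero (x k)).hasDerivAt.comp_hasFDerivAt x
      (EuclideanSpace.proj k : Plane →L[ℝ] ℝ).hasFDerivAt
  have hbump : HasFDerivAt (bump m) _ x := (hcomp 0).mul (hcomp 1)
  have hbound (a b : ℝ) : |bumpLine m a * deriv (bumpLine m) b| ≤ K := by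
    rw [abs_mul, abs_of_nonneg (bumpLine_nonneg _ _)]
    exact (mul_le_of_le_one_left (abs_nonneg _) (bumpLine_le_one _ _)).trans (hK b)
  rw [hbump.fderiv]
  fin_cases i
  · simpa using hbound (x 1) (x 0)
  · simpa using hbound (x 0) (x 1)

lemma integral_bump_sq {m : ℕ} (hm : 0 < m) : ∫ x, bump m x ^ 2 = bumpMass := by
  have hprod (y : Fin 2 → ℝ) : bump m (WithLp.toLp 2 y) ^ 2 = ∏ i, bumpLine m (y i) ^ 2 := by
    simp [bump, mul_pow]
  rw [← (PiLp.volume_preserving_toLp (Fin 2)).integral_comp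
    (MeasurableEquiv.toLp 2 (Fin 2 → ℝ)).measurableEmbedding]
  simp_rw [hprod]
  rw [integral_fintype_prod_volume_eq_prod (fun _ t => bumpLine m t ^ 2), Fin.prod_const,
    integral_bumpLine_sq hm, bumpMass]

/-- The one-particle density of the trial state. -/
noncomputable def bumpDensity (m : ℕ) (x : Plane) : ℝ≥0∞ :=
  ENNReal.ofReal (bump m x ^ 2)

lemma measurable_bumpDensity (m : ℕ) : Measurable (bumpDensity m) :=
  ((contDiff_bump m).continuous.pow 2).measurable.ennreal_ofReal

lemma bumpDensity_le_one (m : ℕ) (x : Plane) : bumpDensity m x ≤ 1 :=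
  ENNReal.ofReal_le_one.mpr (pow_le_one₀ (bump_nonneg m x) (bump_le_one m x))

lemma lintegral_bumpDensity {m : ℕ} (hm : 0 < m) :
    ∫⁻ x, bumpDensity m x = ENNReal.ofReal bumpMass := by
  have hcompact : HasCompactSupport fun x => bump m x ^ 2 :=
    (hasCompactSupport_bump m).comp_left (g := fun t : ℝ => t ^ 2) (zero_pow two_ne_zero)
  have hint : Integrable fun x => bump m x ^ 2 :=
    ((contDiff_bump m).continuous.pow 2).integrable_of_hasCompactSupport hcompact
  unfold bumpDensity
  rw [← integral_bump_sq hm, ofReal_integral_eq_lintegral_ofReal hint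
    (Eventually.of_forall fun _ => sq_nonneg _)]

lemma volume_unitSquare : volume unitSquare = 1 := by
  rw [← (PiLp.volume_preserving_toLp (Fin 2)).measure_preimage
    isCompact_unitSquare.measurableSet.nullMeasurableSet]
  have hpreimage : WithLp.toLp 2 ⁻¹' unitSquare = Set.univ.pi fun _ : Fin 2 => Set.Icc (0 : ℝ) 1 :=
    Set.ext fun x => ⟨fun h i _ => h i, fun h i => h i trivial⟩
  simp [hpreimage, Real.volume_Icc_pi]

lemma lintegral_fderiv_bump_sq_le {m : ℕ} {K : ℝ} (hK : ∀ t, |deriv (bumpLine m) t| ≤ K)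
    (i : Fin 2) :
    ∫⁻ x, ENNReal.ofReal (fderiv ℝ (bump m) x (EuclideanSpace.single i 1) ^ 2) ≤
      ENNReal.ofReal (K ^ 2) := by
  calc ∫⁻ x, ENNReal.ofReal (fderiv ℝ (bump m) x (EuclideanSpace.single i 1) ^ 2)
      ≤ ∫⁻ x, unitSquare.indicator (fun _ => ENNReal.ofReal (K ^ 2)) x := by
        refine lintegral_mono fun x => ?_
        by_cases hx : x ∈ gridInterior m
        · rw [Set.indicator_of_mem (interior_subset (gridInterior_subset_interior m hx))]
          exact ENNReal.ofReal_le_ofReal (sq_le_sq.mpr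
            ((abs_fderiv_bump_le hK x i).trans (le_abs_self K)))
        · simp [(bump_eventuallyEq_zero hx).fderiv_eq]
    _ = ENNReal.ofReal (K ^ 2) := by
        rw [lintegral_indicator_const isCompact_unitSquare.measurableSet, volume_unitSquare,
          mul_one]

end Bump

section RadialIntegral

open Module

lemma integrableOn_Iio_indicator_rpow_Ioi {p : ℝ} (hp : -1 < p) (L : ℝ) :
    IntegrableOn ((Set.Iio L).indicator fun r => r ^ p) (Set.Ioi 0) := by
  rw [IntegrableOn, integrable_indicator_iff measurableSet_Iio, IntegrableOn,
    Measure.restrict_restrict measurableSet_Iio, Set.Iio_inter_Ioi]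
  exact (intervalIntegral.intervalIntegrable_rpow' hp).1.mono_set Set.Ioo_subset_Ioc_self

lemma setIntegral_Ioi_Iio_indicator_rpow {p : ℝ} (hp : -1 < p) {L : ℝ} (hL : 0 ≤ L) :
    ∫ r in Set.Ioi (0 : ℝ), (Set.Iio L).indicator (fun r => r ^ p) r = L ^ (p + 1) / (p + 1) := by
  rw [integral_indicator measurableSet_Iio, Measure.restrict_restrict measurableSet_Iio,
    Set.Iio_inter_Ioi, ← integral_Ioc_eq_integral_Ioo, ← intervalIntegral.integral_of_le hL,
    integral_rpow (Or.inl hp), Real.zero_rpow (by linarith), sub_zero]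

lemma eqOn_pow_smul_indicator_rpow (n : ℕ) (s L : ℝ) :
    Set.EqOn (fun r : ℝ => r ^ n • (Set.Iio L).indicator (fun r => r ^ s) r)
      ((Set.Iio L).indicator fun r => r ^ (s + n)) (Set.Ioi 0) := by
  intro r hr
  by_cases h : r ∈ Set.Iio L
  · simp only [Set.indicator_of_mem h, smul_eq_mul, Real.rpow_add_natCast hr.ne', mul_comm]
  · simp only [Set.indicator_of_notMem h, smul_zero]

variable {E : Type*} [NormedAddCommGroup E] [NormedSpace ℝ E] [FiniteDimensional ℝ E]
  [Nontrivial E] [MeasurableSpace E] [BorelSpace E] (μ : Measure E) [μ.IsAddHaarMeasure]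

lemma lintegral_ball_norm_sub_rpow {s L : ℝ} (hs : -(finrank ℝ E : ℝ) < s) (hL : 0 ≤ L) (y : E) :
    ∫⁻ x in Metric.ball y L, ENNReal.ofReal (‖x - y‖ ^ s) ∂μ =
      ENNReal.ofReal (finrank ℝ E * μ.real (Metric.ball 0 1) *
        (L ^ (s + finrank ℝ E) / (s + finrank ℝ E))) := by
  set f : ℝ → ℝ := (Set.Iio L).indicator fun r => r ^ s
  have hdim : ((finrank ℝ E - 1 : ℕ) : ℝ) = finrank ℝ E - 1 :=
    Nat.cast_pred (finrank_pos (R := ℝ) (M := E))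
  have hp : -1 < s + (finrank ℝ E - 1 : ℕ) := by linarith
  have hf : 0 ≤ᵐ[μ] fun x => f ‖x‖ :=
    Eventually.of_forall fun x => Set.indicator_apply_nonneg fun _ => by positivity
  have hint : Integrable (fun x => f ‖x‖) μ := by
    rw [integrable_fun_norm_addHaar,
      integrableOn_congr_fun (eqOn_pow_smul_indicator_rpow _ s L) measurableSet_Ioi]
    exact integrableOn_Iio_indicator_rpow_Ioi hp L
  calc ∫⁻ x in Metric.ball y L, ENNReal.ofReal (‖x - y‖ ^ s) ∂μ
      = ∫⁻ x, ENNReal.ofReal (f ‖x - y‖) ∂μ := by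
        rw [← lintegral_indicator measurableSet_ball]
        refine lintegral_congr fun x => ?_
        by_cases hx : ‖x - y‖ < L <;> simp [f, Set.indicator, dist_eq_norm, hx]
    _ = ENNReal.ofReal (∫ x, f ‖x‖ ∂μ) := by
        rw [lintegral_sub_right_eq_self (fun x => ENNReal.ofReal (f ‖x‖)) y,
          ofReal_integral_eq_lintegral_ofReal hint hf]
    _ = _ := by
        rw [integral_fun_norm_addHaar,
          setIntegral_congr_fun measurableSet_Ioi (eqOn_pow_smul_indicator_rpow _ s L),
          setIntegral_Ioi_Iio_indicator_rpow hp hL, hdim, nsmul_eq_mul, smul_eq_mul]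
        ring_nf

end RadialIntegral

lemma lintegral_ball_norm_sub_rpow_plane {s L : ℝ} (hs : -2 < s) (hL : 0 ≤ L) (y : Plane) :
    ∫⁻ x in Metric.ball y L, ENNReal.ofReal (‖x - y‖ ^ s) =
      ENNReal.ofReal (2 * Real.pi * (L ^ (s + 2) / (s + 2))) := by
  have hdim : (Module.finrank ℝ Plane : ℝ) = 2 := by simp
  rw [lintegral_ball_norm_sub_rpow volume (by rwa [hdim]) hL, hdim, measureReal_def,
    EuclideanSpace.volume_ball_fin_two]
  simp [Real.pi_nonneg]

section Jastrow

lemma measurable_comp_pair {X Y Z : Type*} [MeasurableSpace X] [MeasurableSpace Y]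
    [MeasurableSpace Z] {f : X → X → Y} (hf : Measurable (Function.uncurry f)) {g h : Z → X}
    (hg : Measurable g) (hh : Measurable h) : Measurable fun z => f (g z) (h z) :=
  hf.comp (hg.prodMk hh)

variable {ι X : Type*} [Fintype ι]

lemma sum_sum_eq_sum_erase_add_two_mul [DecidableEq ι] {R : Type*} [CommSemiring R]
    {w : ι → ι → R} (l : ι) (hsymm : ∀ a, w a l = w l a) (hself : w l l = 0) :
    ∑ a, ∑ b, w a b = ∑ a ∈ Finset.univ.erase l, ∑ b ∈ Finset.univ.erase l, w a b +
      2 * ∑ k ∈ Finset.univ.erase l, w l k := by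
  have hsplit (a : ι) : ∑ b, w a b = w a l + ∑ b ∈ Finset.univ.erase l, w a b :=
    (Finset.add_sum_erase _ _ (Finset.mem_univ l)).symm
  rw [← Finset.add_sum_erase _ _ (Finset.mem_univ l)]
  simp only [hsplit, Finset.sum_add_distrib, hself, hsymm]
  ring

/-- The logarithm of a two-particle Jastrow factor: a symmetric, nonpositive function of two
particles. The value `0` on the diagonal is a convention that allows sums over all pairs of
indices. -/
structure IsRepulsive [MeasurableSpace X] (u : X → X → ℝ) : Prop where
  symm : ∀ s t, u s t = u t s
  self : ∀ t, u t t = 0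
  nonpos : ∀ s t, u s t ≤ 0
  measurable : Measurable (Function.uncurry u)

/-- The density `∏ₐ F(xₐ) ∏_{a < b} exp(2 u(xₐ, x_b))` of a Jastrow wave function. The sum in the
exponent runs over ordered pairs. -/
noncomputable def jastrowDensity (F : X → ℝ≥0∞) (u : X → X → ℝ) (x : ι → X) : ℝ≥0∞ :=
  (∏ a, F (x a)) * ENNReal.ofReal (Real.exp (∑ a, ∑ b, u (x a) (x b)))

/-- The density `jastrowDensity F u` of all particles except the `l`-th. -/
noncomputable def restDensity [DecidableEq ι] (F : X → ℝ≥0∞) (u : X → X → ℝ) (l : ι)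
    (x : ι → X) : ℝ≥0∞ :=
  (∏ a ∈ Finset.univ.erase l, F (x a)) *
    ENNReal.ofReal (Real.exp (∑ a ∈ Finset.univ.erase l, ∑ b ∈ Finset.univ.erase l, u (x a) (x b)))

/-- The Jastrow factor between a particle at `t`, which takes the place of the `l`-th one, and all
the other particles. -/
noncomputable def correlation [DecidableEq ι] (u : X → X → ℝ) (l : ι) (x : ι → X) (t : X) : ℝ≥0∞ :=
  ENNReal.ofReal (Real.exp (2 * ∑ k ∈ Finset.univ.erase l, u t (x k)))

lemma restDensity_update [DecidableEq ι] (F : X → ℝ≥0∞) (u : X → X → ℝ) (l : ι) (x : ι → X)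
    (t : X) :
    restDensity F u l (Function.update x l t) = restDensity F u l x := by
  have hne (k : ι) (hk : k ∈ Finset.univ.erase l) : Function.update x l t k = x k :=
    Function.update_of_ne (Finset.ne_of_mem_erase hk) _ _
  unfold restDensity
  rw [Finset.prod_congr rfl fun a ha => congrArg F (hne a ha),
    Finset.sum_congr rfl fun a ha => Finset.sum_congr rfl fun b hb => by rw [hne a ha, hne b hb]]

lemma correlation_update [DecidableEq ι] (u : X → X → ℝ) (l : ι) (x : ι → X) (s t : X) :
    correlation u l (Function.update x l s) t = correlation u l x t := by
  unfold correlation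
  congr 3
  exact Finset.sum_congr rfl fun k hk => by
    rw [Function.update_of_ne (Finset.ne_of_mem_erase hk)]

variable [MeasurableSpace X] {F : X → ℝ≥0∞} {u : X → X → ℝ}

namespace IsRepulsive

lemma measurable_jastrowDensity (hu : IsRepulsive u) (hF : Measurable F) :
    Measurable (jastrowDensity F u : (ι → X) → ℝ≥0∞) :=
  (Finset.measurable_fun_prod _ fun a _ => hF.comp (measurable_pi_apply a)).mul
    (Real.measurable_exp.comp (Finset.measurable_fun_sum _ fun a _ =>
      Finset.measurable_fun_sum _ fun b _ => measurable_comp_pair hu.measurable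
        (measurable_pi_apply a) (measurable_pi_apply b))).ennreal_ofReal

lemma jastrowDensity_le_one (hu : IsRepulsive u) (hF : ∀ t, F t ≤ 1) (x : ι → X) :
    jastrowDensity F u x ≤ 1 :=
  mul_le_one' (Finset.prod_le_one' fun _ _ => hF _) (ENNReal.ofReal_le_one.mpr
    (Real.exp_le_one_iff.mpr (Finset.sum_nonpos fun _ _ => Finset.sum_nonpos fun _ _ =>
      hu.nonpos _ _)))

variable [DecidableEq ι]

lemma jastrowDensity_eq (hu : IsRepulsive u) (F : X → ℝ≥0∞) (l : ι) (x : ι → X) :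
    jastrowDensity F u x = restDensity F u l x * (F (x l) * correlation u l x (x l)) := by
  rw [jastrowDensity, restDensity, correlation,
    sum_sum_eq_sum_erase_add_two_mul l (fun a => hu.symm _ _) (hu.self _), Real.exp_add,
    ENNReal.ofReal_mul (Real.exp_nonneg _), ← Finset.mul_prod_erase _ _ (Finset.mem_univ l)]
  ring

lemma correlation_le_one (hu : IsRepulsive u) (l : ι) (x : ι → X) (t : X) :
    correlation u l x t ≤ 1 :=
  ENNReal.ofReal_le_one.mpr (Real.exp_le_one_iff.mpr
    (mul_nonpos_of_nonneg_of_nonpos two_pos.le (Finset.sum_nonpos fun _ _ => hu.nonpos _ _)))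

lemma correlation_le (hu : IsRepulsive u) {k l : ι} (hkl : k ≠ l) (x : ι → X) (t : X) :
    correlation u l x t ≤ ENNReal.ofReal (Real.exp (2 * u t (x k))) := by
  have hle : ∑ a ∈ Finset.univ.erase l, u t (x a) ≤ u t (x k) := by
    rw [← Finset.add_sum_erase _ _ (Finset.mem_erase.mpr ⟨hkl, Finset.mem_univ k⟩)]
    exact add_le_of_nonpos_right (Finset.sum_nonpos fun _ _ => hu.nonpos _ _)
  unfold correlation
  gcongr

lemma measurable_correlation (hu : IsRepulsive u) (l : ι) (x : ι → X) :
    Measurable (correlation u l x) :=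
  (Real.measurable_exp.comp ((Finset.measurable_fun_sum _ fun _ _ =>
    measurable_comp_pair hu.measurable measurable_id measurable_const).const_mul 2)).ennreal_ofReal

lemma measurable_restDensity (hu : IsRepulsive u) (hF : Measurable F) (l : ι) :
    Measurable (restDensity F u l) :=
  (Finset.measurable_fun_prod _ fun a _ => hF.comp (measurable_pi_apply a)).mul
    (Real.measurable_exp.comp (Finset.measurable_fun_sum _ fun a _ =>
      Finset.measurable_fun_sum _ fun b _ => measurable_comp_pair hu.measurable
        (measurable_pi_apply a) (measurable_pi_apply b))).ennreal_ofReal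

end IsRepulsive

lemma lintegral_jastrowDensity_ne_zero {μ : Measure X} [SigmaFinite μ]
    (hu : IsRepulsive u) (hFm : Measurable F)
    (hF : ∫⁻ t, F t ∂μ ≠ 0) :
    ∫⁻ x : ι → X, jastrowDensity F u x ∂Measure.pi (fun _ => μ) ≠ 0 := by
  have hsupport : Function.support (jastrowDensity F u : (ι → X) → ℝ≥0∞) =
      Set.univ.pi fun _ => Function.support F := by
    ext x
    simp [jastrowDensity, Finset.prod_eq_zero_iff, Real.exp_pos]
  rw [← pos_iff_ne_zero, lintegral_pos_iff_support hFm] at hF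
  rw [← pos_iff_ne_zero, lintegral_pos_iff_support (hu.measurable_jastrowDensity hFm), hsupport,
    Measure.pi_pi, pos_iff_ne_zero, Finset.prod_ne_zero_iff]
  exact fun _ _ => hF.ne'

variable [DecidableEq ι]

lemma jastrowDensity_le_restDensity (hu : IsRepulsive u) (hF : ∀ t, F t ≤ 1) (l : ι) (x : ι → X) :
    jastrowDensity F u x ≤ restDensity F u l x := by
  rw [hu.jastrowDensity_eq F l]
  exact mul_le_of_le_one_right' (mul_le_one' (hF _) (hu.correlation_le_one _ _ _))

lemma jastrowDensity_le_restDensity_mul (hu : IsRepulsive u) (hF : ∀ t, F t ≤ 1) {k l : ι}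
    (hkl : k ≠ l) (x : ι → X) : jastrowDensity F u x ≤
      restDensity F u l x * ENNReal.ofReal (Real.exp (2 * u (x k) (x l))) := by
  rw [hu.jastrowDensity_eq F l, hu.symm (x k)]
  gcongr
  exact (mul_le_of_le_one_left' (hF _)).trans (hu.correlation_le hkl _ _)

variable {μ : Measure X}

lemma one_le_correlation_add (hu : IsRepulsive u) (l : ι) (x : ι → X) (t : X) :
    1 ≤ correlation u l x t + 2 * ∑ k ∈ Finset.univ.erase l, ENNReal.ofReal (-u (x k) t) := by
  have hneg (k : ι) : 0 ≤ -u (x k) t := neg_nonneg.mpr (hu.nonpos _ _)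
  rw [← ENNReal.ofReal_sum_of_nonneg fun k _ => hneg k, ← ENNReal.ofReal_ofNat 2,
    ← ENNReal.ofReal_mul two_pos.le, correlation, ← ENNReal.ofReal_add (Real.exp_nonneg _)
    (mul_nonneg two_pos.le (Finset.sum_nonneg fun k _ => hneg k)), ← ENNReal.ofReal_one]
  refine ENNReal.ofReal_le_ofReal ?_
  simp only [Finset.sum_neg_distrib, fun k => hu.symm (x k) t]
  linarith [Real.add_one_le_exp (2 * ∑ k ∈ Finset.univ.erase l, u t (x k))]

lemma lintegral_le_lintegral_mul_correlation_add (hu : IsRepulsive u) (hFm : Measurable F)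
    (hF : ∀ t, F t ≤ 1) {B : ℝ≥0∞} (hB : ∀ y, ∫⁻ t, ENNReal.ofReal (-u y t) ∂μ ≤ B) (l : ι)
    (x : ι → X) :
    ∫⁻ t, F t ∂μ ≤ ∫⁻ t, F t * correlation u l x t ∂μ + 2 * (Fintype.card ι * B) := by
  have hmeas (k : ι) : Measurable fun t => ENNReal.ofReal (-u (x k) t) :=
    (measurable_comp_pair hu.measurable measurable_const measurable_id).neg.ennreal_ofReal
  calc ∫⁻ t, F t ∂μ
      ≤ ∫⁻ t, F t * correlation u l x t +
          2 * ∑ k ∈ Finset.univ.erase l, ENNReal.ofReal (-u (x k) t) ∂μ := by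
        refine lintegral_mono fun t => ?_
        calc F t ≤ F t * (correlation u l x t +
              2 * ∑ k ∈ Finset.univ.erase l, ENNReal.ofReal (-u (x k) t)) :=
              le_mul_of_one_le_right' (one_le_correlation_add hu l x t)
          _ ≤ _ := by
              rw [mul_add]
              exact add_le_add_right (mul_le_of_le_one_left' (hF t)) _
    _ = ∫⁻ t, F t * correlation u l x t ∂μ +
          2 * ∑ k ∈ Finset.univ.erase l, ∫⁻ t, ENNReal.ofReal (-u (x k) t) ∂μ := by
        rw [lintegral_add_left (hFm.fun_mul (hu.measurable_correlation l x)),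
          lintegral_const_mul _ (Finset.measurable_fun_sum _ fun k _ => hmeas k),
          lintegral_finsetSum _ fun k _ => hmeas k]
    _ ≤ ∫⁻ t, F t * correlation u l x t ∂μ + 2 * (Fintype.card ι * B) := by
        gcongr
        refine (Finset.sum_le_univ_sum_of_nonneg fun _ => zero_le).trans
          ((Finset.sum_le_card_nsmul _ _ B fun k _ => hB (x k)).trans_eq ?_)
        rw [nsmul_eq_mul, Finset.card_univ]

variable [SigmaFinite μ] {M : ℝ≥0∞}

/- Both sides are compared after integrating out the `l`-th particle. -/
lemma mul_lintegral_restDensity_mul_le (hu : IsRepulsive u) (hFm : Measurable F) {l : ι}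
    (hM : ∀ x, M ≤ ∫⁻ t, F t * correlation u l x t ∂μ) {g h : (ι → X) → ℝ≥0∞} (hg : Measurable g)
    (hh : Measurable h) (hgl : ∀ x t, g (Function.update x l t) = g x) {A : ℝ≥0∞}
    (hA : ∀ x, ∫⁻ t, h (Function.update x l t) ∂μ ≤ A) :
    M * ∫⁻ x, restDensity F u l x * (g x * h x) ∂Measure.pi (fun _ => μ) ≤
      A * ∫⁻ x, jastrowDensity F u x * g x ∂Measure.pi (fun _ => μ) := by
  have hlhs : Measurable fun x => restDensity F u l x * (g x * h x) :=
    (hu.measurable_restDensity hFm l).mul (hg.mul hh)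
  have hrhs : Measurable fun x => jastrowDensity F u x * g x :=
    (hu.measurable_jastrowDensity hFm).mul hg
  rw [← lintegral_const_mul _ hlhs, ← lintegral_const_mul _ hrhs]
  refine lintegral_le_of_lmarginal_le {l} (hlhs.const_mul M) (hrhs.const_mul A) fun x => ?_
  rw [lmarginal_singleton, lmarginal_singleton]
  have hslice : Measurable fun t => h (Function.update x l t) := hh.comp (measurable_update x)
  simp only [hu.jastrowDensity_eq F l, restDensity_update, correlation_update, hgl,
    Function.update_self]
  calc ∫⁻ t, M * (restDensity F u l x * (g x * h (Function.update x l t))) ∂μ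
      = restDensity F u l x * g x * (M * ∫⁻ t, h (Function.update x l t) ∂μ) := by
        rw [lintegral_const_mul _ ((hslice.const_mul _).const_mul _),
          lintegral_const_mul _ (hslice.const_mul _), lintegral_const_mul _ hslice]
        ring
    _ ≤ restDensity F u l x * g x * ((∫⁻ t, F t * correlation u l x t ∂μ) * A) := by
        gcongr
        exacts [hM x, hA x]
    _ = ∫⁻ t, A * (restDensity F u l x * (F t * correlation u l x t) * g x) ∂μ := by
        have hcorr := hFm.fun_mul (hu.measurable_correlation l x)
        rw [lintegral_const_mul _ ((hcorr.const_mul _).mul_const _),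
          lintegral_mul_const _ (hcorr.const_mul _), lintegral_const_mul _ hcorr]
        ring

lemma mul_lintegral_restDensity_mul_apply_le (hu : IsRepulsive u) (hFm : Measurable F) {l : ι}
    (hM : ∀ x, M ≤ ∫⁻ t, F t * correlation u l x t ∂μ) {G : X → ℝ≥0∞} (hG : Measurable G) :
    M * ∫⁻ x, restDensity F u l x * G (x l) ∂Measure.pi (fun _ => μ) ≤
      (∫⁻ t, G t ∂μ) * ∫⁻ x : ι → X, jastrowDensity F u x ∂Measure.pi (fun _ => μ) := by
  simpa using mul_lintegral_restDensity_mul_le hu hFm hM (g := fun _ => 1) (h := fun x => G (x l))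
    measurable_const (hG.comp (measurable_pi_apply l)) (fun _ _ => rfl)
    (fun x => by simp only [Function.update_self, le_rfl])

variable {V : X → X → ℝ≥0∞} {A₁ A₂ : ℝ≥0∞}

lemma mul_lintegral_jastrowDensity_mul_le (hu : IsRepulsive u) (hFm : Measurable F)
    (hF : ∀ t, F t ≤ 1) (hV : Measurable (Function.uncurry V)) (hA₁ : ∀ y, ∫⁻ t, V y t ∂μ ≤ A₁)
    {j l : ι} (hjl : j ≠ l) (hM : ∀ x, M ≤ ∫⁻ t, F t * correlation u l x t ∂μ)
    {g : (ι → X) → ℝ≥0∞} (hg : Measurable g) (hgl : ∀ x t, g (Function.update x l t) = g x) :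
    M * ∫⁻ x, jastrowDensity F u x * (g x * V (x j) (x l)) ∂Measure.pi (fun _ => μ) ≤
      A₁ * ∫⁻ x, jastrowDensity F u x * g x ∂Measure.pi (fun _ => μ) := by
  have hslice := mul_lintegral_restDensity_mul_le hu hFm hM hg
    (measurable_comp_pair hV (measurable_pi_apply j) (measurable_pi_apply l)) hgl
    fun x => by simpa [Function.update_of_ne hjl] using hA₁ (x j)
  refine le_trans ?_ hslice
  gcongr
  exact jastrowDensity_le_restDensity hu hF l _

lemma mul_lintegral_jastrowDensity_mul_sq_le (hu : IsRepulsive u) (hFm : Measurable F)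
    (hF : ∀ t, F t ≤ 1) (hV : Measurable (Function.uncurry V))
    (hA₂ : ∀ y, ∫⁻ t, ENNReal.ofReal (Real.exp (2 * u y t)) * V y t ^ 2 ∂μ ≤ A₂)
    {j l : ι} (hjl : j ≠ l) (hM : ∀ x, M ≤ ∫⁻ t, F t * correlation u l x t ∂μ) :
    M * ∫⁻ x, jastrowDensity F u x * V (x j) (x l) ^ 2 ∂Measure.pi (fun _ => μ) ≤
      A₂ * ∫⁻ x : ι → X, jastrowDensity F u x ∂Measure.pi (fun _ => μ) := by
  have hh : Measurable fun x : ι → X =>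
      ENNReal.ofReal (Real.exp (2 * u (x j) (x l))) * V (x j) (x l) ^ 2 :=
    (Real.measurable_exp.comp ((measurable_comp_pair hu.measurable (measurable_pi_apply j)
      (measurable_pi_apply l)).const_mul 2)).ennreal_ofReal.mul
      ((measurable_comp_pair hV (measurable_pi_apply j) (measurable_pi_apply l)).pow_const 2)
  have hslice := mul_lintegral_restDensity_mul_le hu hFm hM (g := fun _ => 1) measurable_const hh
    (fun _ _ => rfl) (A := A₂) fun x => by simpa [Function.update_of_ne hjl] using hA₂ (x j)
  simp only [one_mul, mul_one] at hslice
  simp only [← mul_assoc] at hslice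
  refine le_trans ?_ hslice
  gcongr
  exact jastrowDensity_le_restDensity_mul hu hF hjl _

lemma sq_mul_lintegral_jastrowDensity_mul_mul_le (hu : IsRepulsive u) (hFm : Measurable F)
    (hF : ∀ t, F t ≤ 1) (hV : Measurable (Function.uncurry V)) (hA₁ : ∀ y, ∫⁻ t, V y t ∂μ ≤ A₁)
    (hM : ∀ (l : ι) x, M ≤ ∫⁻ t, F t * correlation u l x t ∂μ) {j k l : ι} (hjk : j ≠ k)
    (hjl : j ≠ l) (hkl : k ≠ l) :
    M ^ 2 * ∫⁻ x, jastrowDensity F u x * (V (x j) (x k) * V (x j) (x l)) ∂Measure.pi (fun _ => μ) ≤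
      A₁ ^ 2 * ∫⁻ x : ι → X, jastrowDensity F u x ∂Measure.pi (fun _ => μ) := by
  have hk := mul_lintegral_jastrowDensity_mul_le hu hFm hF hV hA₁ hjk (hM k) (g := fun _ => 1)
    measurable_const fun _ _ => rfl
  have hl := mul_lintegral_jastrowDensity_mul_le hu hFm hF hV hA₁ hjl (hM l)
    (measurable_comp_pair hV (measurable_pi_apply j) (measurable_pi_apply k)) fun x t => by
      simp [Function.update_of_ne hjl, Function.update_of_ne hkl]
  simp only [one_mul, mul_one] at hk
  rw [sq, sq, mul_assoc, mul_assoc]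
  calc _ ≤ M * (A₁ * ∫⁻ x, jastrowDensity F u x * V (x j) (x k) ∂Measure.pi (fun _ => μ)) :=
        mul_le_mul_right hl M
    _ = A₁ * (M * ∫⁻ x, jastrowDensity F u x * V (x j) (x k) ∂Measure.pi (fun _ => μ)) :=
        mul_left_comm _ _ _
    _ ≤ _ := by gcongr

lemma sq_mul_lintegral_jastrowDensity_mul_sum_sq_le (hu : IsRepulsive u) (hFm : Measurable F)
    (hF : ∀ t, F t ≤ 1) (hV : Measurable (Function.uncurry V)) (hA₁ : ∀ y, ∫⁻ t, V y t ∂μ ≤ A₁)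
    (hA₂ : ∀ y, ∫⁻ t, ENNReal.ofReal (Real.exp (2 * u y t)) * V y t ^ 2 ∂μ ≤ A₂)
    (hM : ∀ (l : ι) x, M ≤ ∫⁻ t, F t * correlation u l x t ∂μ) (j : ι) :
    M ^ 2 * ∫⁻ x, jastrowDensity F u x * (∑ k ∈ Finset.univ.erase j, V (x j) (x k)) ^ 2
        ∂Measure.pi (fun _ => μ) ≤
      (Fintype.card ι * (M * A₂) + Fintype.card ι ^ 2 * A₁ ^ 2) *
        ∫⁻ x : ι → X, jastrowDensity F u x ∂Measure.pi (fun _ => μ) := by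
  set Z := ∫⁻ x : ι → X, jastrowDensity F u x ∂Measure.pi (fun _ => μ)
  have hmeas (k l : ι) : Measurable fun x : ι → X =>
      jastrowDensity F u x * (V (x j) (x k) * V (x j) (x l)) :=
    (hu.measurable_jastrowDensity hFm).mul
      ((measurable_comp_pair hV (measurable_pi_apply j) (measurable_pi_apply k)).mul
        (measurable_comp_pair hV (measurable_pi_apply j) (measurable_pi_apply l)))
  have hpair (k : ι) (hk : k ∈ Finset.univ.erase j) (l : ι) (hl : l ∈ Finset.univ.erase j) :
      M ^ 2 * ∫⁻ x, jastrowDensity F u x * (V (x j) (x k) * V (x j) (x l))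
          ∂Measure.pi (fun _ => μ) ≤
        (if k = l then M * A₂ * Z else 0) + A₁ ^ 2 * Z := by
    have hjk := (Finset.ne_of_mem_erase hk).symm
    split_ifs with hkl
    · subst hkl
      simp only [← sq]
      rw [sq M, mul_assoc, mul_assoc M]
      exact le_add_right (mul_le_mul_right
        (mul_lintegral_jastrowDensity_mul_sq_le hu hFm hF hV hA₂ hjk (hM k)) M)
    · rw [zero_add]
      exact sq_mul_lintegral_jastrowDensity_mul_mul_le hu hFm hF hV hA₁ hM hjk
        (Finset.ne_of_mem_erase hl).symm hkl
  calc _ = ∑ k ∈ Finset.univ.erase j, ∑ l ∈ Finset.univ.erase j, M ^ 2 *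
        ∫⁻ x, jastrowDensity F u x * (V (x j) (x k) * V (x j) (x l)) ∂Measure.pi (fun _ => μ) := by
        simp only [sq (Finset.sum _ _), Finset.sum_mul_sum]
        simp only [Finset.mul_sum]
        rw [lintegral_finsetSum _ fun k _ => Finset.measurable_fun_sum _ fun l _ => hmeas k l]
        simp only [lintegral_finsetSum _ fun l _ => hmeas _ l, Finset.mul_sum]
    _ ≤ ∑ k : ι, ∑ l : ι, ((if k = l then M * A₂ * Z else 0) + A₁ ^ 2 * Z) :=
        (Finset.sum_le_sum fun k hk => (Finset.sum_le_sum (hpair k hk)).trans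
          (Finset.sum_le_univ_sum_of_nonneg fun _ => zero_le)).trans
          (Finset.sum_le_univ_sum_of_nonneg fun _ => zero_le)
    _ = _ := by
        simp only [Finset.sum_add_distrib, Finset.sum_ite_eq, Finset.mem_univ, if_true,
          Finset.sum_const, Finset.card_univ, nsmul_eq_mul]
        ring

end Jastrow

section PairExponent

/-- The cell of the grid of mesh `1 / m` that contains `x`. -/
noncomputable def cell (m : ℕ) (x : Plane) : Fin 2 → ℤ :=
  fun i => ⌊m * x i⌋

lemma measurable_cell (m : ℕ) : Measurable (cell m) :=
  measurable_pi_lambda _ fun i => Int.measurable_floor.comp (by fun_prop)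

lemma cell_eventuallyEq {m : ℕ} {x : Plane} (hx : x ∈ gridInterior m) :
    ∀ᶠ y in 𝓝 x, cell m y = cell m x := by
  have hcoord (i : Fin 2) : ∀ᶠ y : Plane in 𝓝 x, ⌊m * y i⌋ = ⌊m * x i⌋ := by
    have hcont : Continuous fun y : Plane => m * y i := by fun_prop
    have hlt : (⌊m * x i⌋ : ℝ) < m * x i :=
      (Int.floor_le _).lt_of_ne fun h => (hx i).2 _ h.symm
    filter_upwards [hcont.continuousAt.eventually (Ioo_mem_nhds hlt (Int.lt_floor_add_one _))]
      with y hy using Int.floor_eq_iff.mpr ⟨hy.1.le, hy.2⟩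
  exact (eventually_all.mpr hcoord).mono fun y hy => funext hy

lemma norm_sq_eq_add (z : Plane) : ‖z‖ ^ 2 = z 0 ^ 2 + z 1 ^ 2 := by
  rw [EuclideanSpace.real_norm_sq_eq, Fin.sum_univ_two]

lemma norm_sub_lt_of_cell_eq {m : ℕ} (hm : 0 < m) {x y : Plane} (h : cell m x = cell m y) :
    ‖x - y‖ < 2 / m := by
  have hm' : (0 : ℝ) < m := Nat.cast_pos.mpr hm
  have hcoord (i : Fin 2) : (x i - y i) ^ 2 < (1 / m) ^ 2 := by
    have hfloor := Int.abs_sub_lt_one_of_floor_eq_floor (congrFun h i)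
    rw [← mul_sub, abs_mul, abs_of_pos hm'] at hfloor
    rw [sq_lt_sq, abs_of_pos (one_div_pos.mpr hm'), lt_div_iff₀' hm']
    exact hfloor
  refine lt_of_pow_lt_pow_left₀ 2 (by positivity) ?_
  rw [norm_sq_eq_add, PiLp.sub_apply, PiLp.sub_apply]
  calc (x 0 - y 0) ^ 2 + (x 1 - y 1) ^ 2 < (1 / m) ^ 2 + (1 / m) ^ 2 :=
        add_lt_add (hcoord 0) (hcoord 1)
    _ ≤ (2 / m) ^ 2 := by
      rw [div_pow, div_pow, ← add_div]
      gcongr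
      norm_num

lemma hasFDerivAt_log_const_mul_norm {E : Type*} [NormedAddCommGroup E] [InnerProductSpace ℝ E]
    {c : ℝ} (hc : c ≠ 0) {z : E} (hz : z ≠ 0) :
    HasFDerivAt (fun y : E => Real.log (c * ‖y‖)) ((‖z‖ ^ 2)⁻¹ • innerSL ℝ z) z := by
  have hnorm : ‖z‖ ≠ 0 := norm_ne_zero_iff.mpr hz
  have hsq := (((hasStrictFDerivAt_norm_sq z).hasFDerivAt.const_mul (c ^ 2)).log
    (mul_ne_zero (pow_ne_zero 2 hc) (pow_ne_zero 2 hnorm))).const_mul (1 / 2 : ℝ)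
  refine (hsq.congr_fderiv ?_).congr_of_eventuallyEq (Eventually.of_forall fun y => ?_)
  · ext v
    simp only [_root_.smul_apply, innerSL_apply_apply, smul_eq_mul, nsmul_eq_mul, Nat.cast_ofNat]
    field_simp
  · simp only [← mul_pow, Real.log_pow, Nat.cast_ofNat]
    ring

lemma hasFDerivAt_arctan_div {E : Type*} [NormedAddCommGroup E] [NormedSpace ℝ E] {f g : E → ℝ}
    {f' g' : E →L[ℝ] ℝ} {z : E} (hf : HasFDerivAt f f' z) (hg : HasFDerivAt g g' z)
    (hz : g z ≠ 0) :
    HasFDerivAt (fun y => Real.arctan (f y / g y))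
      ((f z ^ 2 + g z ^ 2)⁻¹ • (g z • f' - f z • g')) z := by
  have hdiv := (hf.fun_mul ((hasDerivAt_inv hz).comp_hasFDerivAt z hg)).arctan
  refine hdiv.congr_fderiv ?_
  have hpos : g z ^ 2 + f z ^ 2 ≠ 0 := by positivity
  have hpos' : f z ^ 2 + g z ^ 2 ≠ 0 := by positivity
  ext v
  simp only [Function.comp_apply, one_div, neg_smul, smul_neg, smul_add, _root_.add_apply,
    _root_.neg_apply, _root_.smul_apply, smul_eq_mul, _root_.sub_apply]
  field_simp
  ring

lemma hasFDerivAt_coord (i : Fin 2) (z : Plane) :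
    HasFDerivAt (fun y : Plane => y i) (EuclideanSpace.proj i : Plane →L[ℝ] ℝ) z :=
  (EuclideanSpace.proj i : Plane →L[ℝ] ℝ).hasFDerivAt

/- `x^{-⊥}` is the gradient of the polar angle, of which this and the next lemma use branches. -/
lemma hasFDerivAt_arctan_one_div_zero {z : Plane} (hz : z 0 ≠ 0) :
    HasFDerivAt (fun y : Plane => Real.arctan (y 1 / y 0)) (innerSL ℝ (invPerp z)) z := by
  refine (hasFDerivAt_arctan_div (hasFDerivAt_coord 1 z) (hasFDerivAt_coord 0 z)
    hz).congr_fderiv ?_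
  ext v
  simp only [_root_.smul_apply, _root_.sub_apply, PiLp.proj_apply, smul_eq_mul,
    invPerp, norm_sq_eq_add, map_smul, coe_innerSL_apply, PiLp.inner_apply, RCLike.inner_apply,
    Real.ringHom_apply, Fin.sum_univ_two, Matrix.cons_val_zero, Matrix.cons_val_one,
    Matrix.cons_val_fin_one]
  ring

lemma hasFDerivAt_arctan_zero_div_one {z : Plane} (hz : z 1 ≠ 0) :
    HasFDerivAt (fun y : Plane => Real.arctan (y 0 / y 1)) (-innerSL ℝ (invPerp z)) z := by
  refine (hasFDerivAt_arctan_div (hasFDerivAt_coord 0 z) (hasFDerivAt_coord 1 z)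
    hz).congr_fderiv ?_
  ext v
  simp only [_root_.smul_apply, _root_.sub_apply, _root_.neg_apply, PiLp.proj_apply, smul_eq_mul,
    invPerp, norm_sq_eq_add, map_smul, coe_innerSL_apply, PiLp.inner_apply, RCLike.inner_apply,
    Real.ringHom_apply, Fin.sum_univ_two, Matrix.cons_val_zero, Matrix.cons_val_one,
    Matrix.cons_val_fin_one]
  ring

/-- The logarithm of the two-particle factor of the trial state, as a function of the relative
position `z` of two particles in the cells `c` and `d`. In a common cell it is the logarithm of the
Jastrow factor `(m ‖z‖ / 2) ^ α`. Otherwise it is the phase that gauges away the mutual vector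
potential: a branch of `-α` times the polar angle, up to a constant. -/
noncomputable def pairKernel (α : ℝ) (m : ℕ) (c d : Fin 2 → ℤ) (z : Plane) : ℂ :=
  if c = d then ((α * Real.log (m / 2 * ‖z‖) : ℝ) : ℂ)
  else if c 0 = d 0 then ((α * Real.arctan (z 0 / z 1) : ℝ) : ℂ) * Complex.I
  else -(((α * Real.arctan (z 1 / z 0) : ℝ) : ℂ) * Complex.I)

/-- The gradient of `pairKernel`, see `hasFDerivAt_pairKernel`. -/
noncomputable def pairKernelDeriv (α : ℝ) (c d : Fin 2 → ℤ) (z : Plane) : Plane →L[ℝ] ℂ :=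
  if c = d then Complex.ofRealCLM ∘L (α • (‖z‖ ^ 2)⁻¹ • innerSL ℝ z)
  else -Complex.I • Complex.ofRealCLM ∘L (α • innerSL ℝ (invPerp z))

lemma hasFDerivAt_pairKernel (α : ℝ) {m : ℕ} (hm : 0 < m) {c d : Fin 2 → ℤ} {z : Plane}
    (hz : z ≠ 0) (hcd : ∀ i, c i ≠ d i → z i ≠ 0) :
    HasFDerivAt (pairKernel α m c d) (pairKernelDeriv α c d z) z := by
  unfold pairKernel pairKernelDeriv
  split_ifs with h h0
  · exact Complex.ofRealCLM.hasFDerivAt.comp z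
      ((hasFDerivAt_log_const_mul_norm (by positivity) hz).const_mul α)
  · have h1 : z 1 ≠ 0 := hcd 1 fun h1 => h (funext (Fin.forall_fin_two.mpr ⟨h0, h1⟩))
    refine ((Complex.ofRealCLM.hasFDerivAt.comp z
      ((hasFDerivAt_arctan_zero_div_one h1).const_mul α)).mul_const Complex.I).congr_fderiv ?_
    ext v
    simp
  · refine ((Complex.ofRealCLM.hasFDerivAt.comp z ((hasFDerivAt_arctan_one_div_zero
      (hcd 0 h0)).const_mul α)).mul_const Complex.I).neg.congr_fderiv ?_
    ext v
    simp

lemma contDiffAt_pairKernel (α : ℝ) {m : ℕ} (hm : 0 < m) {c d : Fin 2 → ℤ} {z : Plane}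
    (hz : z ≠ 0) (hcd : ∀ i, c i ≠ d i → z i ≠ 0) : ContDiffAt ℝ 1 (pairKernel α m c d) z := by
  have hofReal {f : Plane → ℝ} (hf : ContDiffAt ℝ 1 f z) :
      ContDiffAt ℝ 1 (fun y => ((α * f y : ℝ) : ℂ)) z :=
    Complex.ofRealCLM.contDiff.contDiffAt.comp z (contDiffAt_const.mul hf)
  have harctan {i j : Fin 2} (hj : z j ≠ 0) :
      ContDiffAt ℝ 1 (fun y : Plane => Real.arctan (y i / y j)) z :=
    Real.contDiff_arctan.contDiffAt.comp z (ContDiffAt.fun_div (by fun_prop) (by fun_prop) hj)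
  unfold pairKernel
  split_ifs with h h0
  · exact hofReal ((contDiffAt_const.mul (contDiffAt_norm ℝ hz)).log
      (mul_ne_zero (by positivity) (norm_ne_zero_iff.mpr hz)))
  · exact (hofReal (harctan (hcd 1 fun h1 =>
      h (funext (Fin.forall_fin_two.mpr ⟨h0, h1⟩))))).mul contDiffAt_const
  · exact ((hofReal (harctan (hcd 0 h0))).mul contDiffAt_const).neg

lemma norm_magnetic_pairKernelDeriv {α : ℝ} (hα : 0 ≤ α) (c d : Fin 2 → ℤ) (z : Plane)
    (i : Fin 2) :
    ‖-Complex.I * pairKernelDeriv α c d z (EuclideanSpace.single i 1) + α * invPerp z i‖ =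
      if c = d then α * ‖z‖⁻¹ else 0 := by
  unfold pairKernelDeriv
  split_ifs with h
  · have hfactor : -Complex.I * (Complex.ofRealCLM ∘L (α • (‖z‖ ^ 2)⁻¹ • innerSL ℝ z))
        (EuclideanSpace.single i 1) + α * invPerp z i =
          ((α * (‖z‖ ^ 2)⁻¹ : ℝ) : ℂ) * ((!₂[-z 1, z 0] i : ℝ) + (-z i : ℝ) * Complex.I) := by
      simp only [ContinuousLinearMap.comp_smulₛₗ, Real.ringHom_apply, map_inv₀, _root_.smul_apply,
        ContinuousLinearMap.comp_apply, coe_innerSL_apply, EuclideanSpace.inner_single_right,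
        one_mul, Complex.ofRealCLM_apply, Complex.real_smul, Complex.ofReal_inv,
        Complex.ofReal_pow, neg_mul, invPerp, PiLp.smul_apply, smul_eq_mul, Complex.ofReal_mul,
        Complex.ofReal_neg]
      ring
    have hnorm : ‖((!₂[-z 1, z 0] i : ℝ) : ℂ) + (-z i : ℝ) * Complex.I‖ = ‖z‖ := by
      rw [Complex.norm_add_mul_I, Real.sqrt_eq_iff_eq_sq (by positivity) (norm_nonneg z),
        norm_sq_eq_add]
      fin_cases i <;> simp [add_comm]
    rw [hfactor, norm_mul, hnorm, Complex.norm_real, Real.norm_of_nonneg (by positivity), mul_assoc]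
    rcases eq_or_ne ‖z‖ 0 with hz | hz
    · simp [hz]
    · field_simp
  · simp [EuclideanSpace.inner_single_right, ← mul_assoc]

/-- The logarithm of the two-particle factor of the trial state. -/
noncomputable def pairExponent (α : ℝ) (m : ℕ) (x y : Plane) : ℂ :=
  pairKernel α m (cell m x) (cell m y) (x - y)

/-- The logarithm of the modulus of the two-particle factor of the trial state: the particles are
correlated only if they share a cell. -/
noncomputable def pairLog (α : ℝ) (m : ℕ) (x y : Plane) : ℝ :=
  if cell m x = cell m y then α * Real.log (m / 2 * ‖x - y‖) else 0

/-- The interaction of two particles that remains in the energy of the trial state. -/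
noncomputable def pairPotential (α : ℝ) (m : ℕ) (x y : Plane) : ℝ :=
  if cell m x = cell m y then α * ‖x - y‖⁻¹ else 0

lemma pairPotential_nonneg {α : ℝ} (hα : 0 ≤ α) (m : ℕ) (x y : Plane) :
    0 ≤ pairPotential α m x y := by
  unfold pairPotential
  split_ifs <;> positivity

lemma re_pairExponent (α : ℝ) (m : ℕ) (x y : Plane) :
    (pairExponent α m x y).re = pairLog α m x y := by
  unfold pairExponent pairKernel pairLog
  split_ifs <;> simp only [Complex.ofReal_re, Complex.neg_re, Complex.re_ofReal_mul, Complex.I_re,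
    mul_zero, neg_zero]

lemma pairExponent_comm (α : ℝ) (m : ℕ) (x y : Plane) :
    pairExponent α m x y = pairExponent α m y x := by
  unfold pairExponent pairKernel
  rw [← neg_sub y x]
  simp only [norm_neg, PiLp.neg_apply, neg_div_neg_eq, eq_comm]

lemma pairExponent_self (α : ℝ) (m : ℕ) (x : Plane) : pairExponent α m x x = 0 := by
  simp [pairExponent, pairKernel]

lemma pairExponent_eventuallyEq (α : ℝ) {m : ℕ} {x y : Plane} (hx : x ∈ gridInterior m)
    (hy : y ∈ gridInterior m) :
    (fun p : Plane × Plane => pairExponent α m p.1 p.2) =ᶠ[𝓝 (x, y)]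
      fun p => pairKernel α m (cell m x) (cell m y) (p.1 - p.2) := by
  filter_upwards [(continuous_fst.tendsto (x, y)).eventually (cell_eventuallyEq hx),
    (continuous_snd.tendsto (x, y)).eventually (cell_eventuallyEq hy)] with p hp₁ hp₂
  rw [pairExponent, hp₁, hp₂]

lemma sub_apply_ne_zero_of_cell_ne {m : ℕ} {x y : Plane} {i : Fin 2}
    (h : cell m x i ≠ cell m y i) : (x - y) i ≠ 0 := fun hxy => h (by
  rw [PiLp.sub_apply, sub_eq_zero] at hxy
  simp only [cell, hxy])

lemma contDiffAt_pairExponent (α : ℝ) {m : ℕ} (hm : 0 < m) {x y : Plane}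
    (hx : x ∈ gridInterior m) (hy : y ∈ gridInterior m) (hxy : x ≠ y) :
    ContDiffAt ℝ 1 (fun p : Plane × Plane => pairExponent α m p.1 p.2) (x, y) :=
  ((contDiffAt_pairKernel α hm (sub_ne_zero.mpr hxy) fun _ => sub_apply_ne_zero_of_cell_ne).comp
    (f := fun p : Plane × Plane => p.1 - p.2) (x, y) (by fun_prop)).congr_of_eventuallyEq
      (pairExponent_eventuallyEq α hx hy)

lemma hasFDerivAt_pairExponent (α : ℝ) {m : ℕ} (hm : 0 < m) {x y : Plane}
    (hx : x ∈ gridInterior m) (hxy : x ≠ y) :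
    HasFDerivAt (fun t => pairExponent α m t y)
      (pairKernelDeriv α (cell m x) (cell m y) (x - y)) x := by
  have hkernel := hasFDerivAt_pairKernel α hm (sub_ne_zero.mpr hxy)
    fun i => sub_apply_ne_zero_of_cell_ne (m := m) (i := i)
  refine ((hasFDerivAt_comp_sub y).mpr hkernel).congr_of_eventuallyEq ?_
  filter_upwards [cell_eventuallyEq hx] with t ht
  rw [pairExponent, ht]

lemma norm_magnetic_pairExponent {α : ℝ} (hα : 0 ≤ α) (m : ℕ) (x y : Plane) (i : Fin 2) :
    ‖-Complex.I * pairKernelDeriv α (cell m x) (cell m y) (x - y) (EuclideanSpace.single i 1) +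
      α * invPerp (x - y) i‖ = pairPotential α m x y :=
  norm_magnetic_pairKernelDeriv hα _ _ _ i

lemma measurable_pairExponent (α : ℝ) (m : ℕ) :
    Measurable (Function.uncurry (pairExponent α m)) := by
  have hcell₁ : Measurable fun p : Plane × Plane => cell m p.1 :=
    (measurable_cell m).comp measurable_fst
  have hcell₂ : Measurable fun p : Plane × Plane => cell m p.2 :=
    (measurable_cell m).comp measurable_snd
  unfold Function.uncurry pairExponent pairKernel
  refine Measurable.ite (measurableSet_eq_fun hcell₁ hcell₂) ?_ (Measurable.ite
    (measurableSet_eq_fun ((measurable_pi_apply 0).comp hcell₁)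
      ((measurable_pi_apply 0).comp hcell₂)) ?_ ?_) <;> fun_prop

lemma measurable_pairPotential (α : ℝ) (m : ℕ) :
    Measurable (Function.uncurry (pairPotential α m)) :=
  Measurable.ite (measurableSet_eq_fun ((measurable_cell m).comp measurable_fst)
    ((measurable_cell m).comp measurable_snd)) (by fun_prop) measurable_const

lemma isRepulsive_pairLog {α : ℝ} (hα : 0 ≤ α) {m : ℕ} (hm : 0 < m) :
    IsRepulsive (pairLog α m) where
  symm x y := by rw [← re_pairExponent, pairExponent_comm, re_pairExponent]
  self x := by simp [pairLog]
  nonpos x y := by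
    unfold pairLog
    split_ifs with h
    · refine mul_nonpos_of_nonneg_of_nonpos hα (Real.log_nonpos (by positivity) ?_)
      calc (m : ℝ) / 2 * ‖x - y‖ ≤ m / 2 * (2 / m) := by
            gcongr
            exact (norm_sub_lt_of_cell_eq hm h).le
        _ = 1 := by field_simp
    · exact le_rfl
  measurable := by
    have hre : Function.uncurry (pairLog α m) =
        fun p => (Function.uncurry (pairExponent α m) p).re :=
      funext fun p => (re_pairExponent α m p.1 p.2).symm
    rw [hre]
    exact Complex.measurable_re.comp (measurable_pairExponent α m)

end PairExponent

section PairIntegrals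

variable {α : ℝ} {m : ℕ}

lemma lintegral_ite_cell_eq_le (hm : 0 < m) (f : Plane → ℝ≥0∞) (y : Plane) :
    ∫⁻ t, (if cell m y = cell m t then f t else 0) ≤ ∫⁻ t in Metric.ball y (2 / m), f t := by
  rw [← lintegral_indicator Metric.isOpen_ball.measurableSet]
  refine lintegral_mono fun t => ?_
  split_ifs with h
  · rw [Set.indicator_of_mem]
    rw [Metric.mem_ball', dist_eq_norm]
    exact norm_sub_lt_of_cell_eq hm h
  · exact zero_le

lemma lintegral_pairPotential_le (hα : 0 ≤ α) (hm : 0 < m) (y : Plane) :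
    ∫⁻ t, ENNReal.ofReal (pairPotential α m y t) ≤
      ENNReal.ofReal (2 * Real.pi * (α * (2 / m))) := by
  simp only [pairPotential, apply_ite ENNReal.ofReal, ENNReal.ofReal_zero]
  refine (lintegral_ite_cell_eq_le hm _ y).trans_eq ?_
  simp only [ENNReal.ofReal_mul hα, norm_sub_rev y, ← Real.rpow_neg_one]
  rw [lintegral_const_mul' _ _ ENNReal.ofReal_ne_top,
    lintegral_ball_norm_sub_rpow_plane (by norm_num) (by positivity), ← ENNReal.ofReal_mul hα]
  congr 1
  norm_num
  ring

lemma exp_two_mul_pairLog_mul_pairPotential_sq_le (hm : 0 < m) (y t : Plane) :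
    Real.exp (2 * pairLog α m y t) * pairPotential α m y t ^ 2 ≤
      if cell m y = cell m t then α ^ 2 * (m / 2) ^ (2 * α) * ‖t - y‖ ^ (2 * α - 2) else 0 := by
  unfold pairLog pairPotential
  split_ifs with h
  · rcases eq_or_ne t y with rfl | hne
    · simp only [sub_self, norm_zero, inv_zero, mul_zero, zero_pow two_ne_zero]
      positivity
    · have hr : 0 < ‖t - y‖ := norm_pos_iff.mpr (sub_ne_zero.mpr hne)
      have hexp : Real.exp (2 * (α * Real.log (m / 2 * ‖t - y‖))) =
          (m / 2) ^ (2 * α) * ‖t - y‖ ^ (2 * α) := by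
        rw [← Real.mul_rpow (by positivity) hr.le, Real.rpow_def_of_pos (by positivity)]
        ring_nf
      rw [norm_sub_rev y, hexp, Real.rpow_sub hr, Real.rpow_two]
      apply le_of_eq
      field_simp
  · simp

lemma lintegral_exp_mul_pairPotential_sq_le (hα : 0 ≤ α) (hm : 0 < m) (y : Plane) :
    ∫⁻ t, ENNReal.ofReal (Real.exp (2 * pairLog α m y t)) *
        ENNReal.ofReal (pairPotential α m y t) ^ 2 ≤ ENNReal.ofReal (Real.pi * α) := by
  rcases hα.eq_or_lt with rfl | hα'
  · simp [pairPotential]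
  have hm' : (0 : ℝ) < m := Nat.cast_pos.mpr hm
  have hcancel : ((m : ℝ) / 2) ^ (2 * α) * (2 / m) ^ (2 * α) = 1 := by
    rw [← Real.mul_rpow (by positivity) (by positivity), div_mul_div_cancel₀ two_ne_zero,
      div_self hm'.ne', Real.one_rpow]
  calc _ ≤ ∫⁻ t, if cell m y = cell m t then
          ENNReal.ofReal (α ^ 2 * (m / 2) ^ (2 * α) * ‖t - y‖ ^ (2 * α - 2)) else 0 := by
        refine lintegral_mono fun t => ?_
        rw [← ENNReal.ofReal_pow (pairPotential_nonneg hα m y t),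
          ← ENNReal.ofReal_mul (Real.exp_nonneg _), ← ENNReal.ofReal_zero,
          ← apply_ite ENNReal.ofReal]
        exact ENNReal.ofReal_le_ofReal (exp_two_mul_pairLog_mul_pairPotential_sq_le hm y t)
    _ ≤ ∫⁻ t in Metric.ball y (2 / m),
          ENNReal.ofReal (α ^ 2 * (m / 2) ^ (2 * α) * ‖t - y‖ ^ (2 * α - 2)) :=
        lintegral_ite_cell_eq_le hm _ y
    _ = ENNReal.ofReal (α ^ 2 * (m / 2) ^ (2 * α) *
          (2 * Real.pi * ((2 / m) ^ (2 * α) / (2 * α)))) := by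
        simp only [ENNReal.ofReal_mul (show 0 ≤ α ^ 2 * ((m : ℝ) / 2) ^ (2 * α) by positivity)]
        rw [lintegral_const_mul' _ _ ENNReal.ofReal_ne_top,
          lintegral_ball_norm_sub_rpow_plane (by linarith) (by positivity), sub_add_cancel]
    _ = ENNReal.ofReal (Real.pi * α) := by
        rw [← mul_one (Real.pi * α), ← hcancel]
        congr 1
        field_simp

lemma neg_pairLog_le (hα : 0 ≤ α) (hm : 0 < m) (x y : Plane) :
    -pairLog α m x y ≤ 2 / m * pairPotential α m x y := by
  unfold pairLog pairPotential
  split_ifs with h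
  · rcases eq_or_ne x y with rfl | hne
    · simp
    · have hr : 0 < ‖x - y‖ := norm_pos_iff.mpr (sub_ne_zero.mpr hne)
      have hlog := Real.one_sub_inv_le_log_of_pos (x := m / 2 * ‖x - y‖) (by positivity)
      calc -(α * Real.log (m / 2 * ‖x - y‖)) = α * -Real.log (m / 2 * ‖x - y‖) := by ring
        _ ≤ α * (m / 2 * ‖x - y‖)⁻¹ := by
          gcongr
          linarith
        _ = 2 / m * (α * ‖x - y‖⁻¹) := by
          rw [mul_inv, inv_div]
          ring
  · simp

lemma lintegral_neg_pairLog_le (hα : 0 ≤ α) (hm : 0 < m) (y : Plane) :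
    ∫⁻ t, ENNReal.ofReal (-pairLog α m y t) ≤
      ENNReal.ofReal (2 * Real.pi * (α * (2 / m) ^ 2)) := by
  calc _ ≤ ∫⁻ t, ENNReal.ofReal (2 / m) * ENNReal.ofReal (pairPotential α m y t) := by
        refine lintegral_mono fun t => ?_
        rw [← ENNReal.ofReal_mul (by positivity)]
        exact ENNReal.ofReal_le_ofReal (neg_pairLog_le hα hm y t)
    _ ≤ ENNReal.ofReal (2 / m) * ENNReal.ofReal (2 * Real.pi * (α * (2 / m))) := by
        rw [lintegral_const_mul' _ _ ENNReal.ofReal_ne_top]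
        gcongr
        exact lintegral_pairPotential_le hα hm y
    _ = _ := by
        rw [← ENNReal.ofReal_mul (by positivity)]
        ring_nf

end PairIntegrals

section MagneticGradient

variable {N : ℕ} {α : ℝ} {Ψ : Config N → ℂ}

lemma fderiv_apply_single {ι E F : Type*} [Finite ι] [DecidableEq ι] [NormedAddCommGroup E]
    [NormedSpace ℝ E] [NormedAddCommGroup F] [NormedSpace ℝ F] {f : (ι → E) → F} {x : ι → E}
    {j : ι} {L : E →L[ℝ] F} (hf : DifferentiableAt ℝ f x)
    (hL : HasFDerivAt (fun t => f (Function.update x j t)) L (x j)) (v : E) :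
    fderiv ℝ f x (Pi.single j v) = L v := by
  have := Fintype.ofFinite ι
  have hupdate := hasFDerivAt_update (𝕜 := ℝ) x (i := j) (x j)
  have hf' : HasFDerivAt f (fderiv ℝ f x) (Function.update x j (x j)) := by
    rw [Function.update_eq_self]
    exact hf.hasFDerivAt
  rw [hL.unique (hf'.comp (x j) hupdate), ContinuousLinearMap.comp_apply]
  congr 1
  ext k
  rcases eq_or_ne k j with rfl | hk
  · simp
  · simp [hk]

lemma integral_fderiv_apply_eq_zero {E : Type*} [NormedAddCommGroup E] [NormedSpace ℝ E]
    [FiniteDimensional ℝ E] [MeasurableSpace E] [BorelSpace E] {μ : Measure E}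
    [μ.IsAddHaarMeasure] {u : E → ℂ} (hu : ContDiff ℝ 1 u) (hs : HasCompactSupport u) (v : E) :
    ∫ x, fderiv ℝ u x v ∂μ = 0 := by
  have hint : Integrable (fun x => fderiv ℝ u x v) μ :=
    ((hu.continuous_fderiv one_ne_zero).clm_apply
      continuous_const).integrable_of_hasCompactSupport (hs.fderiv_apply ℝ v)
  have hparts := integral_smul_fderiv_eq_neg_fderiv_smul_of_integrable (μ := μ) (𝕜 := ℂ) (f := u)
    (g := fun _ : E => (1 : ℂ)) (v := v) (by simpa using hint) (by simp)
    (by simpa using hu.continuous.integrable_of_hasCompactSupport hs)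
    (fun x _ => (hu.differentiable one_ne_zero).differentiableAt)
    (fun x _ => differentiableAt_const _)
  simpa using hparts

lemma isOpen_offDiagonal (N : ℕ) : IsOpen (offDiagonal N) := by
  simp only [offDiagonal, Function.Injective, Set.ofPred_forall]
  refine isOpen_iInter_of_finite fun a => isOpen_iInter_of_finite fun b => ?_
  rcases eq_or_ne a b with rfl | hab
  · simp
  · simpa only [hab, imp_false] using isOpen_ne_fun (continuous_apply a) (continuous_apply b)

lemma continuousAt_invPerp {z : Plane} (hz : z ≠ 0) : ContinuousAt invPerp z := by
  have hnorm : ‖z‖ ^ 2 ≠ 0 := pow_ne_zero 2 (norm_ne_zero_iff.mpr hz)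
  unfold invPerp
  fun_prop (disch := assumption)

lemma vecPot_apply (j : Fin N) (x : Config N) (i : Fin 2) :
    vecPot j x i = ∑ k ∈ Finset.univ.erase j, invPerp (x j - x k) i := by
  simp [vecPot]

lemma continuousOn_vecPot (j : Fin N) : ContinuousOn (vecPot j) (offDiagonal N) := by
  intro x hx
  refine ContinuousAt.continuousWithinAt (tendsto_finsetSum _ fun k hk => ?_)
  have hne : x j - x k ≠ 0 := sub_ne_zero.mpr (hx.ne (Finset.ne_of_mem_erase hk).symm)
  exact (continuousAt_invPerp hne).comp (f := fun y : Config N => y j - y k) (by fun_prop)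

/-- The classical gradient `D_α Ψ` of a function `Ψ` that is differentiable off the diagonals. On
the diagonals, where the vector potential is singular, it is set to `0`. -/
noncomputable def magneticGradient (α : ℝ) (Ψ : Config N → ℂ) (j : Fin N) (i : Fin 2) :
    Config N → ℂ :=
  (offDiagonal N).indicator fun x =>
    -Complex.I * fderiv ℝ Ψ x (direction j i) + (α : ℂ) * ((vecPot j x i : ℝ) : ℂ) * Ψ x

lemma continuousOn_magneticGradient (α : ℝ) (hΨ : ∀ x ∈ offDiagonal N, ContDiffAt ℝ 1 Ψ x)
    (j : Fin N) (i : Fin 2) : ContinuousOn (magneticGradient α Ψ j i) (offDiagonal N) := by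
  have hΨ' : ContDiffOn ℝ 1 Ψ (offDiagonal N) := fun x hx => (hΨ x hx).contDiffWithinAt
  have hfderiv := hΨ'.continuousOn_fderiv_of_isOpen (isOpen_offDiagonal N) le_rfl
  have hpot : ContinuousOn (fun x : Config N => vecPot j x i) (offDiagonal N) :=
    (EuclideanSpace.proj i : Plane →L[ℝ] ℝ).continuous.comp_continuousOn (continuousOn_vecPot j)
  exact ((continuousOn_const.mul (hfderiv.clm_apply continuousOn_const)).add
    ((continuousOn_const.mul (Complex.continuous_ofReal.comp_continuousOn hpot)).mul
      hΨ'.continuousOn)).congr fun x hx => Set.indicator_of_mem hx _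

lemma measurable_magneticGradient (α : ℝ) (hΨ : ∀ x ∈ offDiagonal N, ContDiffAt ℝ 1 Ψ x)
    (j : Fin N) (i : Fin 2) : Measurable (magneticGradient α Ψ j i) := by
  classical
  have hpiecewise := (continuousOn_magneticGradient α hΨ j i).measurable_piecewise
    (continuousOn_const (c := 0)) (isOpen_offDiagonal N).measurableSet
  have hself : (offDiagonal N).piecewise (magneticGradient α Ψ j i) (fun _ => 0) =
      magneticGradient α Ψ j i := by
    ext x
    by_cases hx : x ∈ offDiagonal N <;> simp [magneticGradient, hx]
  rwa [hself] at hpiecewise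

lemma mul_eventuallyEq_zero_of_notMem_tsupport {X R : Type*} [TopologicalSpace X]
    [MulZeroClass R] {φ : X → R} {x : X} (hx : x ∉ tsupport φ) (f : X → R) :
    (fun y => f y * φ y) =ᶠ[𝓝 x] fun _ => 0 := by
  filter_upwards [notMem_tsupport_iff_eventuallyEq.mp hx] with y hy
  rw [hy, Pi.zero_apply, mul_zero]

lemma IsTestFunction.continuous_mul {φ f : Config N → ℂ} (hφ : IsTestFunction φ)
    (hf : ContinuousOn f (offDiagonal N)) : Continuous fun x => f x * φ x :=
  continuous_iff_continuousAt.mpr fun x => by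
    by_cases hx : x ∈ tsupport φ
    · exact (hf.continuousAt ((isOpen_offDiagonal N).mem_nhds (hφ.support_subset hx))).mul
        hφ.smooth.continuous.continuousAt
    · exact continuousAt_const.congr (mul_eventuallyEq_zero_of_notMem_tsupport hx f).symm

lemma IsTestFunction.contDiff_mul {φ : Config N → ℂ} (hφ : IsTestFunction φ)
    (hΨ : ∀ x ∈ offDiagonal N, ContDiffAt ℝ 1 Ψ x) : ContDiff ℝ 1 fun x => Ψ x * φ x :=
  contDiff_iff_contDiffAt.mpr fun x => by
    by_cases hx : x ∈ tsupport φ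
    · exact (hΨ x (hφ.support_subset hx)).mul (hφ.smooth.contDiffAt.of_le (by simp))
    · exact contDiffAt_const.congr_of_eventuallyEq (mul_eventuallyEq_zero_of_notMem_tsupport hx Ψ)

lemma IsTestFunction.mul_magnetic_eq {φ : Config N → ℂ} (hφ : IsTestFunction φ)
    (hΨ : ∀ x ∈ offDiagonal N, ContDiffAt ℝ 1 Ψ x) (j : Fin N) (i : Fin 2) (x : Config N) :
    Ψ x * (Complex.I * fderiv ℝ φ x (direction j i)
        + (α : ℂ) * ((vecPot j x i : ℝ) : ℂ) * φ x) =
      magneticGradient α Ψ j i x * φ x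
        + Complex.I * fderiv ℝ (fun y => Ψ y * φ y) x (direction j i) := by
  by_cases hx : x ∈ tsupport φ
  · have hmul := ((hΨ x (hφ.support_subset hx)).differentiableAt one_ne_zero).hasFDerivAt.fun_mul
      (hφ.smooth.differentiable (by simp) x).hasFDerivAt
    rw [hmul.fderiv, magneticGradient, Set.indicator_of_mem (hφ.support_subset hx)]
    simp only [_root_.add_apply, _root_.smul_apply, smul_eq_mul]
    ring
  · rw [fderiv_of_notMem_tsupport ℝ hx, image_eq_zero_of_notMem_tsupport hx,
      (mul_eventuallyEq_zero_of_notMem_tsupport hx Ψ).fderiv_eq, fderiv_fun_const]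
    simp

lemma isMagneticGradient_magneticGradient (α : ℝ)
    (hΨ : ∀ x ∈ offDiagonal N, ContDiffAt ℝ 1 Ψ x) :
    IsMagneticGradient α Ψ (magneticGradient α Ψ) := by
  intro j i φ hφ
  have hgradient : Integrable fun x => magneticGradient α Ψ j i x * φ x :=
    (hφ.continuous_mul (continuousOn_magneticGradient α hΨ
      j i)).integrable_of_hasCompactSupport hφ.compact_support.mul_left
  have hderiv : Integrable fun x => fderiv ℝ (fun y => Ψ y * φ y) x (direction j i) :=
    (((hφ.contDiff_mul hΨ).continuous_fderiv one_ne_zero).clm_apply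
      continuous_const).integrable_of_hasCompactSupport
        (hφ.compact_support.mul_left.fderiv_apply ℝ _)
  simp only [hφ.mul_magnetic_eq hΨ]
  rw [integral_add hgradient (hderiv.const_mul _), integral_const_mul,
    integral_fderiv_apply_eq_zero (hφ.contDiff_mul hΨ) hφ.compact_support.mul_left, mul_zero,
    add_zero]

end MagneticGradient

section Trial

variable {N : ℕ} {α : ℝ} {m : ℕ}

/-- The trial wave function, not normalized, of the particles with index in `s`. In the exponent
every pair is counted twice. -/
noncomputable def trial (α : ℝ) (m : ℕ) (s : Finset (Fin N)) (x : Config N) : ℂ :=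
  ((∏ a ∈ s, bump m (x a) : ℝ) : ℂ) *
    Complex.exp (1 / 2 * ∑ a ∈ s, ∑ b ∈ s, pairExponent α m (x a) (x b))

/-- The dependence of the trial wave function on the position `t` of the `j`-th particle. -/
noncomputable def trialSlice (α : ℝ) (m : ℕ) (j : Fin N) (x : Config N) (t : Plane) : ℂ :=
  (bump m t : ℂ) * Complex.exp (∑ k ∈ Finset.univ.erase j, pairExponent α m t (x k))

lemma trial_univ_eq (α : ℝ) (m : ℕ) (j : Fin N) (x : Config N) :
    trial α m Finset.univ x =
      trial α m (Finset.univ.erase j) x * trialSlice α m j x (x j) := by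
  rw [trial, trial, trialSlice, sum_sum_eq_sum_erase_add_two_mul j
    (fun a => pairExponent_comm α m _ _) (pairExponent_self α m _), mul_add, Complex.exp_add,
    ← Finset.mul_prod_erase _ _ (Finset.mem_univ j), Complex.ofReal_mul]
  ring_nf

lemma trial_update (α : ℝ) (m : ℕ) (j : Fin N) (x : Config N) (t : Plane) :
    trial α m Finset.univ (Function.update x j t) =
      trial α m (Finset.univ.erase j) x * trialSlice α m j x t := by
  have hne (k : Fin N) (hk : k ∈ Finset.univ.erase j) : Function.update x j t k = x k :=
    Function.update_of_ne (Finset.ne_of_mem_erase hk) _ _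
  rw [trial_univ_eq α m j, Function.update_self, trial, trial, trialSlice, trialSlice,
    Finset.prod_congr rfl fun a ha => congrArg (bump m) (hne a ha),
    Finset.sum_congr rfl fun a ha => Finset.sum_congr rfl fun b hb => by rw [hne a ha, hne b hb],
    Finset.sum_congr rfl fun k hk => congrArg (pairExponent α m t) (hne k hk)]

lemma enorm_exp_sq (z : ℂ) : ‖Complex.exp z‖ₑ ^ 2 = ENNReal.ofReal (Real.exp (2 * z.re)) := by
  rw [← ofReal_norm, Complex.norm_exp, ← ENNReal.ofReal_pow (Real.exp_nonneg _),
    ← Real.exp_nat_mul, Nat.cast_ofNat]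

lemma enorm_ofReal_sq (r : ℝ) : ‖(r : ℂ)‖ₑ ^ 2 = ENNReal.ofReal (r ^ 2) := by
  rw [← ofReal_norm, Complex.norm_real, ← ENNReal.ofReal_pow (norm_nonneg _), Real.norm_eq_abs,
    sq_abs]

lemma enorm_trial_sq (α : ℝ) (m : ℕ) (s : Finset (Fin N)) (x : Config N) :
    ‖trial α m s x‖ₑ ^ 2 = (∏ a ∈ s, bumpDensity m (x a)) *
      ENNReal.ofReal (Real.exp (∑ a ∈ s, ∑ b ∈ s, pairLog α m (x a) (x b))) := by
  have hre : 2 * (1 / 2 * ∑ a ∈ s, ∑ b ∈ s, pairExponent α m (x a) (x b)).re =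
      ∑ a ∈ s, ∑ b ∈ s, pairLog α m (x a) (x b) := by
    rw [show (1 / 2 : ℂ) = (1 / 2 : ℝ) by norm_num, Complex.re_ofReal_mul, Complex.re_sum]
    simp only [Complex.re_sum, re_pairExponent]
    ring
  rw [trial, enorm_mul, mul_pow, enorm_exp_sq, hre, enorm_ofReal_sq, ← Finset.prod_pow,
    ENNReal.ofReal_prod_of_nonneg fun _ _ => sq_nonneg _]
  rfl

lemma measurable_trial (α : ℝ) (m : ℕ) (s : Finset (Fin N)) : Measurable (trial α m s) := by
  refine (Complex.measurable_ofReal.comp (Finset.measurable_fun_prod _ fun a _ =>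
    (contDiff_bump m).continuous.measurable.comp (measurable_pi_apply a))).mul
    (Complex.measurable_exp.comp ((Finset.measurable_fun_sum _ fun a _ =>
      Finset.measurable_fun_sum _ fun b _ => ?_).const_mul _))
  exact measurable_comp_pair (measurable_pairExponent α m) (measurable_pi_apply a)
    (measurable_pi_apply b)

lemma trial_comp_perm (α : ℝ) (m : ℕ) (σ : Equiv.Perm (Fin N)) (x : Config N) :
    trial α m Finset.univ (x ∘ σ) = trial α m Finset.univ x := by
  have hsum : ∑ a, ∑ b, pairExponent α m (x (σ a)) (x (σ b)) =
      ∑ a, ∑ b, pairExponent α m (x a) (x b) := by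
    rw [← Equiv.sum_comp σ fun a => ∑ b, pairExponent α m (x a) (x b)]
    exact Finset.sum_congr rfl fun a _ => Equiv.sum_comp σ fun b => pairExponent α m (x (σ a)) (x b)
  simp only [trial, Function.comp_apply, hsum, Equiv.prod_comp σ fun a => bump m (x a)]

lemma trial_eventuallyEq_zero (α : ℝ) {x : Config N} {j : Fin N} (hj : x j ∉ gridInterior m) :
    trial α m Finset.univ =ᶠ[𝓝 x] 0 := by
  filter_upwards [((continuous_apply j).tendsto x).eventually (bump_eventuallyEq_zero hj)] with y hy
  rw [trial, Finset.prod_eq_zero (Finset.mem_univ j) hy, Complex.ofReal_zero, zero_mul,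
    Pi.zero_apply]

lemma contDiffAt_trial (α : ℝ) (hm : 0 < m) {x : Config N} (hx : x ∈ offDiagonal N) :
    ContDiffAt ℝ 1 (trial α m Finset.univ) x := by
  by_cases hgrid : ∀ j, x j ∈ gridInterior m
  · have hbump : ContDiff ℝ 1 fun y : Config N => ∏ a, bump m (y a) :=
      contDiff_prod fun a _ => (contDiff_bump m).comp (contDiff_apply ℝ Plane a)
    refine (Complex.ofRealCLM.contDiff.contDiffAt.comp x hbump.contDiffAt).mul
      ((contDiffAt_const.mul (ContDiffAt.sum fun a _ => ContDiffAt.sum fun b _ => ?_)).cexp)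
    rcases eq_or_ne a b with rfl | hab
    · simp only [pairExponent_self, contDiffAt_const]
    · exact (contDiffAt_pairExponent α hm (hgrid a) (hgrid b) (hx.ne hab)).comp
        (f := fun y : Config N => (y a, y b)) x
        ((contDiff_apply ℝ Plane a).prodMk (contDiff_apply ℝ Plane b)).contDiffAt
  · push Not at hgrid
    obtain ⟨j, hj⟩ := hgrid
    exact contDiffAt_const.congr_of_eventuallyEq (trial_eventuallyEq_zero α hj)

lemma trial_eq_zero (α : ℝ) {x : Config N} (hx : x ∉ power N (tsupport (bump m))) :
    trial α m Finset.univ x = 0 := by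
  obtain ⟨j, hj⟩ : ∃ j, x j ∉ tsupport (bump m) := by
    simpa [power, Set.mem_pi] using hx
  have hbump : bump m (x j) = 0 := image_eq_zero_of_notMem_tsupport hj
  rw [trial, Finset.prod_eq_zero (Finset.mem_univ j) hbump, Complex.ofReal_zero, zero_mul]

lemma hasFDerivAt_trialSlice (α : ℝ) (hm : 0 < m) {x : Config N} (hx : x ∈ offDiagonal N)
    {j : Fin N} (hj : x j ∈ gridInterior m) :
    HasFDerivAt (trialSlice α m j x)
      (Complex.exp (∑ k ∈ Finset.univ.erase j, pairExponent α m (x j) (x k)) •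
        (Complex.ofRealCLM ∘L fderiv ℝ (bump m) (x j) + (bump m (x j) : ℂ) •
          ∑ k ∈ Finset.univ.erase j, pairKernelDeriv α (cell m (x j)) (cell m (x k)) (x j - x k)))
      (x j) := by
  have hbump := Complex.ofRealCLM.hasFDerivAt.comp (x j)
    ((contDiff_bump m).differentiable one_ne_zero (x j)).hasFDerivAt
  have hexponent := HasFDerivAt.fun_sum fun k (hk : k ∈ Finset.univ.erase j) =>
    hasFDerivAt_pairExponent α hm hj (hx.ne (Finset.ne_of_mem_erase hk).symm)
  refine (hbump.mul hexponent.cexp).congr_fderiv ?_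
  ext v
  simp only [_root_.add_apply, _root_.smul_apply, smul_eq_mul, Function.comp_apply,
    Complex.ofRealCLM_apply]
  ring

lemma magneticGradient_trial (α : ℝ) (hm : 0 < m) {x : Config N} (hx : x ∈ offDiagonal N)
    {j : Fin N} (hj : x j ∈ gridInterior m) (i : Fin 2) :
    magneticGradient α (trial α m Finset.univ) j i x =
      trial α m (Finset.univ.erase j) x *
        Complex.exp (∑ k ∈ Finset.univ.erase j, pairExponent α m (x j) (x k)) *
        (-Complex.I * fderiv ℝ (bump m) (x j) (EuclideanSpace.single i 1) +
          bump m (x j) * ∑ k ∈ Finset.univ.erase j, (-Complex.I *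
            pairKernelDeriv α (cell m (x j)) (cell m (x k)) (x j - x k)
              (EuclideanSpace.single i 1) + α * invPerp (x j - x k) i)) := by
  have hslice := (hasFDerivAt_trialSlice α hm hx hj).const_mul
    (trial α m (Finset.univ.erase j) x)
  simp only [← trial_update] at hslice
  rw [magneticGradient, Set.indicator_of_mem hx, direction,
    fderiv_apply_single ((contDiffAt_trial α hm hx).differentiableAt one_ne_zero) hslice,
    trial_univ_eq α m j, vecPot_apply, trialSlice, Finset.sum_add_distrib, ← Finset.mul_sum,
    ← Finset.mul_sum]
  simp only [_root_.add_apply, _root_.smul_apply, smul_eq_mul, ContinuousLinearMap.comp_apply,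
    _root_.sum_apply, Complex.ofRealCLM_apply, Complex.ofReal_sum]
  ring

lemma magneticGradient_trial_eq_zero (α : ℝ) {x : Config N} {j : Fin N}
    (hj : x j ∉ gridInterior m) (i : Fin 2) :
    magneticGradient α (trial α m Finset.univ) j i x = 0 := by
  have hzero := trial_eventuallyEq_zero α hj
  rw [magneticGradient, Set.indicator_apply_eq_zero]
  intro
  rw [hzero.fderiv_eq, hzero.eq_of_nhds]
  simp

lemma enorm_add_sq_le {E : Type*} [TopologicalSpace E] [ESeminormedAddMonoid E] (a b : E) :
    ‖a + b‖ₑ ^ 2 ≤ 2 * (‖a‖ₑ ^ 2 + ‖b‖ₑ ^ 2) := by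
  have hpow := ENNReal.rpow_add_le_mul_rpow_add_rpow ‖a‖ₑ ‖b‖ₑ one_le_two
  norm_num [ENNReal.rpow_ofNat] at hpow
  exact (pow_le_pow_left' (enorm_add_le a b) 2).trans hpow

lemma enorm_exp_sum_pairExponent_sq (α : ℝ) (m : ℕ) (j : Fin N) (x : Config N) (t : Plane) :
    ‖Complex.exp (∑ k ∈ Finset.univ.erase j, pairExponent α m t (x k))‖ₑ ^ 2 =
      correlation (pairLog α m) j x t := by
  simp only [enorm_exp_sq, Complex.re_sum, re_pairExponent, correlation]

lemma enorm_sum_magnetic_pairExponent_le (hα : 0 ≤ α) (m : ℕ) (x : Config N) (j : Fin N)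
    (i : Fin 2) :
    ‖∑ k ∈ Finset.univ.erase j, (-Complex.I *
      pairKernelDeriv α (cell m (x j)) (cell m (x k)) (x j - x k) (EuclideanSpace.single i 1) +
        α * invPerp (x j - x k) i)‖ₑ ≤
      ∑ k ∈ Finset.univ.erase j, ENNReal.ofReal (pairPotential α m (x j) (x k)) := by
  refine (enorm_sum_le _ _).trans_eq (Finset.sum_congr rfl fun k _ => ?_)
  rw [← ofReal_norm, norm_magnetic_pairExponent hα]

lemma enorm_magneticGradient_trial_sq_le (hα : 0 ≤ α) (hm : 0 < m) (x : Config N) (j : Fin N)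
    (i : Fin 2) :
    ‖magneticGradient α (trial α m Finset.univ) j i x‖ₑ ^ 2 ≤
      2 * (restDensity (bumpDensity m) (pairLog α m) j x *
          ENNReal.ofReal (fderiv ℝ (bump m) (x j) (EuclideanSpace.single i 1) ^ 2) +
        jastrowDensity (bumpDensity m) (pairLog α m) x *
          (∑ k ∈ Finset.univ.erase j, ENNReal.ofReal (pairPotential α m (x j) (x k))) ^ 2) := by
  have hu := isRepulsive_pairLog hα hm
  by_cases hx : x ∈ offDiagonal N
  swap
  · simp [magneticGradient, hx]
  by_cases hj : x j ∈ gridInterior m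
  swap
  · simp [magneticGradient_trial_eq_zero α hj]
  have hrest : ‖trial α m (Finset.univ.erase j) x‖ₑ ^ 2 =
      restDensity (bumpDensity m) (pairLog α m) j x :=
    enorm_trial_sq α m _ x
  rw [magneticGradient_trial α hm hx hj, enorm_mul, enorm_mul, mul_pow, mul_pow, hrest,
    enorm_exp_sum_pairExponent_sq, hu.jastrowDensity_eq _ j x]
  have hpotential := enorm_sum_magnetic_pairExponent_le hα m x j i
  set R := restDensity (bumpDensity m) (pairLog α m) j x
  set ρ := correlation (pairLog α m) j x (x j)
  set T := ∑ k ∈ Finset.univ.erase j, ENNReal.ofReal (pairPotential α m (x j) (x k))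
  set D := ENNReal.ofReal (fderiv ℝ (bump m) (x j) (EuclideanSpace.single i 1) ^ 2)
  calc _ ≤ R * ρ * (2 * (D + bumpDensity m (x j) * T ^ 2)) := by
        gcongr
        refine (enorm_add_sq_le _ _).trans ?_
        rw [enorm_mul, enorm_mul, mul_pow, mul_pow, enorm_neg, enorm_ofReal_sq, enorm_ofReal_sq,
          ← ofReal_norm, Complex.norm_I, ENNReal.ofReal_one, one_pow, one_mul, bumpDensity]
        gcongr
    _ = 2 * (R * (D * ρ) + R * (bumpDensity m (x j) * ρ) * T ^ 2) := by ring
    _ ≤ _ := by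
        gcongr
        exact mul_le_of_le_one_right' (hu.correlation_le_one j x (x j))

end Trial

section Variational

variable {N : ℕ} {α : ℝ} {Ω : Set Plane} {Ψ : Config N → ℂ} {G : Fin N → Fin 2 → Config N → ℂ}

lemma HasMagneticGradient.const_mul (h : HasMagneticGradient α Ψ G) (c : ℂ) :
    HasMagneticGradient α (fun x => c * Ψ x) (fun j i x => c * G j i x) where
  memLp := h.memLp.const_mul c
  bosonic σ := by
    filter_upwards [h.bosonic σ] with x hx
    rw [hx]
  memLp_gradient j i := (h.memLp_gradient j i).const_mul c
  isMagneticGradient j i φ hφ := by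
    simp only [mul_assoc c, integral_const_mul, h.isMagneticGradient j i φ hφ]

lemma HasCompactSupportIn.const_mul (h : HasCompactSupportIn Ω Ψ) (c : ℂ) :
    HasCompactSupportIn Ω fun x => c * Ψ x := by
  obtain ⟨K, hK, hKΩ, hzero⟩ := h
  refine ⟨K, hK, hKΩ, ?_⟩
  filter_upwards [hzero] with x hx hxK
  rw [hx hxK, mul_zero]

lemma lintegral_enorm_const_mul_sq (μ : Measure (Config N)) (c : ℂ) (f : Config N → ℂ) :
    ∫⁻ x, ‖c * f x‖ₑ ^ 2 ∂μ = ‖c‖ₑ ^ 2 * ∫⁻ x, ‖f x‖ₑ ^ 2 ∂μ := by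
  simp only [enorm_mul, mul_pow]
  exact lintegral_const_mul' _ _ (ENNReal.pow_ne_top enorm_ne_top)

lemma kineticEnergy_const_mul (Ω : Set Plane) (G : Fin N → Fin 2 → Config N → ℂ) (c : ℂ) :
    kineticEnergy Ω (fun j i x => c * G j i x) = ‖c‖ₑ ^ 2 * kineticEnergy Ω G := by
  simp only [kineticEnergy, enorm_mul, mul_pow, ← Finset.mul_sum]
  rw [Finset.mul_sum]
  exact Finset.sum_congr rfl fun j _ =>
    lintegral_const_mul' _ _ (ENNReal.pow_ne_top enorm_ne_top)

lemma exists_enorm_sq_eq {r : ℝ≥0∞} (hr : r ≠ ⊤) : ∃ c : ℂ, ‖c‖ₑ ^ 2 = r :=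
  ⟨(√r.toReal : ℝ), by
    rw [enorm_ofReal_sq, Real.sq_sqrt ENNReal.toReal_nonneg, ENNReal.ofReal_toReal hr]⟩

lemma dirichletEnergy_le (h : HasMagneticGradient α Ψ G) (hs : HasCompactSupportIn Ω Ψ)
    (h0 : ∫⁻ x in power N Ω, ‖Ψ x‖ₑ ^ 2 ≠ 0) (htop : ∫⁻ x in power N Ω, ‖Ψ x‖ₑ ^ 2 ≠ ⊤) {B : ℝ≥0∞}
    (hB : kineticEnergy Ω G ≤ B * ∫⁻ x in power N Ω, ‖Ψ x‖ₑ ^ 2) :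
    dirichletEnergy N α Ω ≤ B := by
  obtain ⟨c, hc⟩ := exists_enorm_sq_eq (ENNReal.inv_ne_top.mpr h0)
  have hnormalized : ∫⁻ x in power N Ω, ‖c * Ψ x‖ₑ ^ 2 = 1 := by
    rw [lintegral_enorm_const_mul_sq, hc, ENNReal.inv_mul_cancel h0 htop]
  calc dirichletEnergy N α Ω ≤ kineticEnergy Ω fun j i x => c * G j i x :=
        sInf_le ⟨_, _, h.const_mul c, hs.const_mul c, hnormalized, rfl⟩
    _ ≤ ‖c‖ₑ ^ 2 * (B * ∫⁻ x in power N Ω, ‖Ψ x‖ₑ ^ 2) := by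
        rw [kineticEnergy_const_mul]
        gcongr
    _ = B := by
        rw [mul_left_comm, hc, ENNReal.inv_mul_cancel h0 htop, mul_one]

lemma memLp_two_of_lintegral_lt_top {X : Type*} [MeasurableSpace X] {μ : Measure X} {f : X → ℂ}
    (hf : AEStronglyMeasurable f μ) (h : ∫⁻ x, ‖f x‖ₑ ^ 2 ∂μ < ⊤) : MemLp f 2 μ := by
  refine ⟨hf, (eLpNorm_lt_top_iff_lintegral_rpow_enorm_lt_top two_ne_zero ENNReal.ofNat_ne_top).mpr
    ?_⟩
  simpa using h

end Variational

section Energy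

variable {N : ℕ} {α K : ℝ} {m : ℕ}

lemma lintegral_power_unitSquare_enorm_trial_sq (α : ℝ) (m : ℕ) :
    ∫⁻ x in power N unitSquare, ‖trial α m Finset.univ x‖ₑ ^ 2 =
      ∫⁻ x : Config N, jastrowDensity (bumpDensity m) (pairLog α m) x := by
  have hsupport : Function.support (fun x : Config N => ‖trial α m Finset.univ x‖ₑ ^ 2) ⊆
      power N unitSquare := fun x hx => by
    have htrial : trial α m Finset.univ x ≠ 0 := fun h => hx (by simp [h])
    have hbump : x ∈ power N (tsupport (bump m)) := by_contra fun h => htrial (trial_eq_zero α h)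
    exact fun j hj => interior_subset
      (gridInterior_subset_interior m (tsupport_bump_subset m (hbump j hj)))
  rw [setLIntegral_eq_of_support_subset hsupport]
  exact lintegral_congr fun x => enorm_trial_sq α m Finset.univ x

lemma lintegral_jastrowDensity_bumpDensity_ne_top (hα : 0 ≤ α) (hm : 0 < m) :
    ∫⁻ x : Config N, jastrowDensity (bumpDensity m) (pairLog α m) x ≠ ⊤ := by
  have hcompact : IsCompact (power N unitSquare) := isCompact_univ_pi fun _ => isCompact_unitSquare
  rw [← lintegral_power_unitSquare_enorm_trial_sq]
  refine ne_top_of_le_ne_top (hcompact.measure_ne_top (μ := volume)) ?_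
  rw [← setLIntegral_one]
  exact lintegral_mono fun x => (enorm_trial_sq α m Finset.univ x).trans_le
    ((isRepulsive_pairLog hα hm).jastrowDensity_le_one (bumpDensity_le_one m) x)

lemma half_bumpMass_le_lintegral (hα : 0 ≤ α) (hm : 0 < m)
    (hmesh : 32 * Real.pi * α * N ≤ bumpMass * m ^ 2) (l : Fin N) (x : Config N) :
    ENNReal.ofReal (bumpMass / 2) ≤
      ∫⁻ t, bumpDensity m t * correlation (pairLog α m) l x t := by
  have hc := bumpMass_pos
  have hlost : 2 * (N * ENNReal.ofReal (2 * Real.pi * (α * (2 / m) ^ 2))) ≤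
      ENNReal.ofReal (bumpMass / 2) := by
    have hdiv := div_le_of_le_mul₀ (by positivity) hc.le hmesh
    rw [← ENNReal.ofReal_ofNat 2, ← ENNReal.ofReal_natCast, ← ENNReal.ofReal_mul N.cast_nonneg,
      ← ENNReal.ofReal_mul two_pos.le]
    refine ENNReal.ofReal_le_ofReal ?_
    calc _ = 32 * Real.pi * α * N / m ^ 2 / 2 := by ring
      _ ≤ bumpMass / 2 := by gcongr
  refine (ENNReal.add_le_add_iff_right (ENNReal.ofReal_ne_top (r := bumpMass / 2))).mp ?_
  calc ENNReal.ofReal (bumpMass / 2) + ENNReal.ofReal (bumpMass / 2)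
      = ∫⁻ t, bumpDensity m t := by
        rw [← ENNReal.ofReal_add (by positivity) (by positivity), add_halves,
          lintegral_bumpDensity hm]
    _ ≤ (∫⁻ t, bumpDensity m t * correlation (pairLog α m) l x t) +
          2 * (N * ENNReal.ofReal (2 * Real.pi * (α * (2 / m) ^ 2))) := by
        simpa only [Fintype.card_fin] using
          lintegral_le_lintegral_mul_correlation_add (isRepulsive_pairLog hα hm)
            (measurable_bumpDensity m) (bumpDensity_le_one m) (lintegral_neg_pairLog_le hα hm) l x
    _ ≤ _ := by gcongr

lemma pairPotential_coefficients_le (hα : 0 ≤ α) (hmesh : 32 * Real.pi * α * N ≤ bumpMass * m ^ 2) :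
    N * (ENNReal.ofReal (bumpMass / 2) * ENNReal.ofReal (Real.pi * α)) +
        N ^ 2 * ENNReal.ofReal (2 * Real.pi * (α * (2 / m))) ^ 2 ≤
      ENNReal.ofReal (bumpMass / 2) * ENNReal.ofReal (2 * Real.pi * α * N) := by
  have hc := bumpMass_pos
  have hdiv := div_le_of_le_mul₀ (by positivity) hc.le hmesh
  rw [← ENNReal.ofReal_natCast, ← ENNReal.ofReal_pow N.cast_nonneg,
    ← ENNReal.ofReal_pow (by positivity), ← ENNReal.ofReal_mul (by positivity),
    ← ENNReal.ofReal_mul N.cast_nonneg, ← ENNReal.ofReal_mul (by positivity),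
    ← ENNReal.ofReal_mul (by positivity), ← ENNReal.ofReal_add (by positivity) (by positivity)]
  refine ENNReal.ofReal_le_ofReal ?_
  calc _ = N * (bumpMass / 2 * (Real.pi * α)) +
          Real.pi * α * N / 2 * (32 * Real.pi * α * N / m ^ 2) := by ring
    _ ≤ N * (bumpMass / 2 * (Real.pi * α)) + Real.pi * α * N / 2 * bumpMass := by gcongr
    _ = bumpMass / 2 * (2 * Real.pi * α * N) := by ring

lemma mul_lintegral_jastrowDensity_mul_sum_pairPotential_sq_le (hα : 0 ≤ α) (hm : 0 < m)
    (hmesh : 32 * Real.pi * α * N ≤ bumpMass * m ^ 2) (j : Fin N) :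
    ENNReal.ofReal (bumpMass / 2) *
      ∫⁻ x : Config N, jastrowDensity (bumpDensity m) (pairLog α m) x *
        (∑ k ∈ Finset.univ.erase j, ENNReal.ofReal (pairPotential α m (x j) (x k))) ^ 2 ≤
      ENNReal.ofReal (2 * Real.pi * α * N) *
        ∫⁻ x : Config N, jastrowDensity (bumpDensity m) (pairLog α m) x := by
  have hsq := sq_mul_lintegral_jastrowDensity_mul_sum_sq_le (isRepulsive_pairLog hα hm)
    (V := fun y t => ENNReal.ofReal (pairPotential α m y t)) (measurable_bumpDensity m)
    (bumpDensity_le_one m) (measurable_pairPotential α m).ennreal_ofReal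
    (lintegral_pairPotential_le hα hm) (lintegral_exp_mul_pairPotential_sq_le hα hm)
    (half_bumpMass_le_lintegral hα hm hmesh) j
  rw [Fintype.card_fin, sq (ENNReal.ofReal (bumpMass / 2)), mul_assoc] at hsq
  refine (ENNReal.mul_le_mul_iff_right (ENNReal.ofReal_pos.mpr (half_pos bumpMass_pos)).ne'
    ENNReal.ofReal_ne_top).mp (hsq.trans ?_)
  rw [← mul_assoc (ENNReal.ofReal (bumpMass / 2))]
  exact mul_le_mul_left (pairPotential_coefficients_le hα hmesh) _

lemma lintegral_magneticGradient_trial_sq_le (hα : 0 ≤ α) (hm : 0 < m)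
    (hmesh : 32 * Real.pi * α * N ≤ bumpMass * m ^ 2) (hK : ∀ t, |deriv (bumpLine m) t| ≤ K)
    (j : Fin N) (i : Fin 2) :
    ∫⁻ x, ‖magneticGradient α (trial α m Finset.univ) j i x‖ₑ ^ 2 ≤
      ENNReal.ofReal (4 * (K ^ 2 + 2 * Real.pi * α * N) / bumpMass) *
        ∫⁻ x : Config N, jastrowDensity (bumpDensity m) (pairLog α m) x := by
  have hc := bumpMass_pos
  have hu := isRepulsive_pairLog hα hm
  set Z := ∫⁻ x : Config N, jastrowDensity (bumpDensity m) (pairLog α m) x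
  have hDm : Measurable fun t =>
      ENNReal.ofReal (fderiv ℝ (bump m) t (EuclideanSpace.single i 1) ^ 2) :=
    ((measurable_fderiv_apply_const ℝ (bump m) _).pow_const 2).ennreal_ofReal
  have hrest : Measurable fun x : Config N => restDensity (bumpDensity m) (pairLog α m) j x *
      ENNReal.ofReal (fderiv ℝ (bump m) (x j) (EuclideanSpace.single i 1) ^ 2) :=
    (hu.measurable_restDensity (measurable_bumpDensity m) j).mul
      (hDm.comp (measurable_pi_apply j))
  have hbump := (mul_lintegral_restDensity_mul_apply_le hu (measurable_bumpDensity m)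
    (half_bumpMass_le_lintegral hα hm hmesh j) hDm).trans
    (mul_le_mul_left (lintegral_fderiv_bump_sq_le hK i) Z)
  have hpotential := mul_lintegral_jastrowDensity_mul_sum_pairPotential_sq_le hα hm hmesh j
  refine (ENNReal.mul_le_mul_iff_right (ENNReal.ofReal_pos.mpr (half_pos hc)).ne'
    ENNReal.ofReal_ne_top).mp ?_
  calc _ ≤ _ := mul_le_mul_right (lintegral_mono fun x =>
        enorm_magneticGradient_trial_sq_le hα hm x j i) _
    _ ≤ 2 * (ENNReal.ofReal (K ^ 2) * Z + ENNReal.ofReal (2 * Real.pi * α * N) * Z) := by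
        rw [lintegral_const_mul' _ _ ENNReal.ofNat_ne_top, lintegral_add_left hrest, mul_left_comm,
          mul_add]
        exact mul_le_mul_right (add_le_add hbump hpotential) 2
    _ = ENNReal.ofReal (2 * (K ^ 2 + 2 * Real.pi * α * N)) * Z := by
        rw [ENNReal.ofReal_mul two_pos.le, ENNReal.ofReal_add (by positivity) (by positivity),
          ENNReal.ofReal_ofNat]
        ring
    _ = _ := by
        rw [← mul_assoc, ← ENNReal.ofReal_mul (by positivity)]
        congr 2
        field_simp
        ring

lemma hasMagneticGradient_trial (hα : 0 ≤ α) (hm : 0 < m)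
    (hmesh : 32 * Real.pi * α * N ≤ bumpMass * m ^ 2) :
    HasMagneticGradient α (trial α m (Finset.univ : Finset (Fin N)))
      (magneticGradient α (trial α m Finset.univ)) where
  memLp := by
    refine memLp_two_of_lintegral_lt_top (measurable_trial α m _).aestronglyMeasurable ?_
    rw [lintegral_congr (enorm_trial_sq α m Finset.univ)]
    exact (lintegral_jastrowDensity_bumpDensity_ne_top hα hm).lt_top
  bosonic σ := Eventually.of_forall (trial_comp_perm α m σ)
  memLp_gradient j i := by
    obtain ⟨K, -, hK⟩ := exists_abs_deriv_bumpWave_le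
    exact memLp_two_of_lintegral_lt_top
      (measurable_magneticGradient α (fun _ => contDiffAt_trial α hm) j i).aestronglyMeasurable
      ((lintegral_magneticGradient_trial_sq_le hα hm hmesh (abs_deriv_bumpLine_le hK m) j
        i).trans_lt (ENNReal.mul_lt_top ENNReal.ofReal_lt_top
          (lintegral_jastrowDensity_bumpDensity_ne_top hα hm).lt_top))
  isMagneticGradient := isMagneticGradient_magneticGradient α fun _ => contDiffAt_trial α hm

lemma hasCompactSupportIn_trial (α : ℝ) (m : ℕ) :
    HasCompactSupportIn unitSquare (trial α m (Finset.univ : Finset (Fin N))) :=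
  ⟨tsupport (bump m), hasCompactSupport_bump m,
    (tsupport_bump_subset m).trans (gridInterior_subset_interior m),
    Eventually.of_forall fun _ => trial_eq_zero α⟩

lemma kineticEnergy_trial_le (hα : 0 ≤ α) (hm : 0 < m)
    (hmesh : 32 * Real.pi * α * N ≤ bumpMass * m ^ 2) (hK : ∀ t, |deriv (bumpLine m) t| ≤ K) :
    kineticEnergy unitSquare (magneticGradient α (trial α m (Finset.univ : Finset (Fin N)))) ≤
      ENNReal.ofReal (8 * N * (K ^ 2 + 2 * Real.pi * α * N) / bumpMass) *
        ∫⁻ x : Config N, jastrowDensity (bumpDensity m) (pairLog α m) x := by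
  set e := 4 * (K ^ 2 + 2 * Real.pi * α * N) / bumpMass
  set Z := ∫⁻ x : Config N, jastrowDensity (bumpDensity m) (pairLog α m) x
  have hparticle (j : Fin N) : ∫⁻ x in power N unitSquare,
      ∑ i, ‖magneticGradient α (trial α m Finset.univ) j i x‖ₑ ^ 2 ≤
        2 * (ENNReal.ofReal e * Z) := by
    refine (setLIntegral_le_lintegral _ _).trans ?_
    rw [lintegral_finsetSum _ fun i _ => (measurable_magneticGradient α
      (fun _ => contDiffAt_trial α hm) j i).enorm.pow_const 2]
    refine (Finset.sum_le_card_nsmul _ _ _ fun i _ =>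
      lintegral_magneticGradient_trial_sq_le hα hm hmesh hK j i).trans_eq ?_
    rw [Finset.card_univ, Fintype.card_fin, nsmul_eq_mul, Nat.cast_ofNat]
  calc _ ≤ N * (2 * (ENNReal.ofReal e * Z)) := by
        refine (Finset.sum_le_card_nsmul _ _ _ fun j _ => hparticle j).trans_eq ?_
        rw [Finset.card_univ, Fintype.card_fin, nsmul_eq_mul]
    _ = ENNReal.ofReal (N * (2 * e)) * Z := by
        rw [ENNReal.ofReal_mul N.cast_nonneg, ENNReal.ofReal_mul two_pos.le,
          ENNReal.ofReal_natCast, ENNReal.ofReal_ofNat, mul_assoc, mul_assoc]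
    _ = _ := by
        congr 2
        ring

lemma dirichletEnergy_unitSquare_le (hα : 0 ≤ α) (hm : 0 < m)
    (hmesh : 32 * Real.pi * α * N ≤ bumpMass * m ^ 2) (hK : ∀ t, |deriv (bumpLine m) t| ≤ K) :
    dirichletEnergy N α unitSquare ≤
      ENNReal.ofReal (8 * N * (K ^ 2 + 2 * Real.pi * α * N) / bumpMass) := by
  have hnorm := lintegral_power_unitSquare_enorm_trial_sq (N := N) α m
  refine dirichletEnergy_le (hasMagneticGradient_trial hα hm hmesh) (hasCompactSupportIn_trial α m)
    ?_ ?_ ?_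
  · rw [hnorm]
    refine lintegral_jastrowDensity_ne_zero (isRepulsive_pairLog hα hm)
      (measurable_bumpDensity m) ?_
    rw [lintegral_bumpDensity hm]
    exact (ENNReal.ofReal_pos.mpr bumpMass_pos).ne'
  · rw [hnorm]
    exact lintegral_jastrowDensity_bumpDensity_ne_top hα hm
  · rw [hnorm]
    exact kineticEnergy_trial_le hα hm hmesh hK

lemma exists_nat_sq_between {s : ℝ} (hs : 0 ≤ s) :
    ∃ m : ℕ, 0 < m ∧ s ≤ (m : ℝ) ^ 2 ∧ (m : ℝ) ^ 2 ≤ 2 * s + 8 := by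
  have hlower := Nat.le_ceil √s
  have hupper := Nat.ceil_lt_add_one (Real.sqrt_nonneg s)
  refine ⟨⌈√s⌉₊ + 1, Nat.succ_pos _, ?_, ?_⟩ <;> push_cast
  · nlinarith [Real.sq_sqrt hs, Real.sqrt_nonneg s]
  · nlinarith [Real.sq_sqrt hs, Real.sqrt_nonneg s, sq_nonneg (√s - 2)]

end Energy

end Anyon

open Anyon

theorem mainTheorem3_general :
    ∃ C : ℝ, 0 < C ∧ ∀ α : ℝ, 0 ≤ α → ∀ N : ℕ,
      Anyon.dirichletEnergy N α Anyon.unitSquare ≤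
        ENNReal.ofReal (C * ((N : ℝ) + α * (N : ℝ) ^ 2)) := by
  obtain ⟨K, hK₀, hK⟩ := exists_abs_deriv_bumpWave_le
  have hc := bumpMass_pos
  set c := bumpMass
  refine ⟨8 / c * (8 * K ^ 2 + 64 * Real.pi * K ^ 2 / c + 2 * Real.pi), by positivity,
    fun α hα N => ?_⟩
  obtain ⟨m, hm, hmesh, hm_le⟩ :=
    exists_nat_sq_between (s := 32 * Real.pi * α * N / c) (by positivity)
  refine (dirichletEnergy_unitSquare_le hα hm ((div_le_iff₀' hc).mp hmesh)
    (abs_deriv_bumpLine_le hK m)).trans (ENNReal.ofReal_le_ofReal ?_)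
  have hαN : 0 ≤ α * N := by positivity
  calc 8 * N * ((K * m) ^ 2 + 2 * Real.pi * α * N) / c
      = 8 / c * N * (K ^ 2 * m ^ 2 + 2 * Real.pi * (α * N)) := by ring
    _ ≤ 8 / c * N * (K ^ 2 * (2 * (32 * Real.pi * α * N / c) + 8) + 2 * Real.pi * (α * N)) := by
        gcongr
    _ = 8 / c * N * (8 * K ^ 2 * 1 + (64 * Real.pi * K ^ 2 / c + 2 * Real.pi) * (α * N)) := by
        ring
    _ ≤ 8 / c * N * (8 * K ^ 2 * (1 + α * N) +
          (64 * Real.pi * K ^ 2 / c + 2 * Real.pi) * (1 + α * N)) := by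
        gcongr <;> linarith
    _ = _ := by ring

theorem mainTheorem3 :
    ∃ C : ℝ, 0 < C ∧ ∀ α : ℝ, 0 ≤ α → α ≤ 1 → ∀ N : ℕ, 1 ≤ N →
      Anyon.dirichletEnergy N α Anyon.unitSquare ≤
        ENNReal.ofReal (C * ((N : ℝ) + α * (N : ℝ) ^ 2)) :=
  let ⟨C, hC, hbound⟩ := mainTheorem3_general
  ⟨C, hC, fun α hα _ N _ => hbound α hα N⟩
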